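/- **Divergence.** Let $\rho$ be a measure on $\mathbb R$, let $\Theta$ be the interior of $\{\theta:\int e^{\theta x}\,d\rho(x)<\infty\}$, let $P_\theta$ ($\theta\in\Theta$) be the canonical one-parameter exponential family with densities $e^{\theta x-b(\theta)}$ with respect to $\rho$, and let $M$ be the set of the means of its members. Write $\mathrm{KL}(x,q)$ for the Kullback–Leibler divergence $\mathrm{KL}(P_\theta,P_{\theta'})$ of the members with means $x,q\in M$, extended to the boundary of $M$ by lower semicontinuity (as for Bernoulli laws at $0$ and $1$), and equal to $\infty$ outside the closure of $M$. Let $I=[\mathrm{lo},\mathrm{hi}]$ with $\mathrm{lo}<\mathrm{hi}$ be a compact interval in the closure of $M$. **Arms.** Let $K\ge2$. All $K$ arms have the same reward distribution $\nu$, which is $1$-sub-Gaussian (that is, $\int e^{\lambda(x-\mu)}\,d\nu(x)\le e^{\lambda^2/2}$ for all $\lambda\in\mathbb R$), has positive variance, has mean $\mu\in I$, and satisfies $\mathrm{KL}(x,\mu)<\infty$ for $\nu$-almost every $x$ (which is automatic if $\nu$ is one of the $P_\theta$). Suppose that for some $c>0$ $$\mathrm{KL}(x,q)\ \ge\ c\,(x-q)^2\qquad\text{for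 all } q\in I \text{ and all } x \text{ in the convex hull of the support of } \nu ,$$ that is, $\mathrm{KL}(\widehat\mu,q)\ge c(\widehat\mu-q)^2$ for all values $\widehat\mu$ of the empirical means. The rewards of the successive pulls of the arms are independent with law $\nu$. **Algorithms.** With horizon $T$, each arm is pulled once in the first $K$ rounds; then round $t+1$ pulls an arm with the largest index $U_a(t)$, ties being broken arbitrarily. Here $n=n_{a,t}$ is the number of pulls of arm $a$ in the first $t$ rounds, $\widehat\mu=\widehat\mu_a(t)$ is the mean of its rewards so far, $\log^+x=\max(0,\log x)$, and $\sup\emptyset=-\infty$. The index is one of the following. * KL-MOSS: $U^{KM}_a(t)=\sup\{q\in I:\mathrm{KL}(\widehat\mu,q)\le \log^+(T/n)/n\}$. * KL-UCB++: $\sup\{q\in I:\mathrm{KL}(\widehat\mu,q)\le h(n)/n\}$ with $h(n)=\log^+\!\big(\tfrac{T/K}{n}(\log^+\tfrac{T/K}{n})^2+1\big)$. * KL-UCB-Switch: $U^{KM}_a(t)$ if $n\le\lfloor (T/K)^{1/5}\rfloor$, and $\widehat\mu+\sqrt{\max\{0,\log\frac{T/K}{n}\}/n}$ otherwise. * Anytime-KL-UCB-Switch: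 $\sup\{q\in I:\mathrm{KL}(\widehat\mu,q)\le \phi(\tfrac{t}{Kn})/n\}$ if $n\le\lfloor (t/K)^{1/5}\rfloor$, and $\widehat\mu+\sqrt{\tfrac1{2n}\phi(\tfrac{t}{Kn})}$ otherwise, with $\phi(x)=\log^+(x)\,(1+(\log^+x)^2)$. **Claim.** Each of the four algorithms is unstable: it is not the case that for every arm $a$ there are non-random scalars $n^*_{a,T}\to\infty$ with $n_{a,T}/n^*_{a,T}\to1$ in probability as $T\to\infty$, where $n_{a,T}$ is the number of pulls of arm $a$ in $T$ rounds with horizon $T$. -/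

import Mathlib

open MeasureTheory ProbabilityTheory Filter Topology
open scoped ENNReal

namespace KLBandit

noncomputable section

/-! ### The Kullback-Leibler divergence of a canonical exponential family, in terms of means -/

/-- The open natural parameter set of the canonical exponential family generated by the
dominating measure `ρ`: the interior of `{θ | ∫ exp (θ x) dρ(x) < ∞}`. -/
def natParams (ρ : Measure ℝ) : Set ℝ := interior (integrableExpSet id ρ)

/-- The member `P_θ` of the family: density `exp (θ x - b θ)` with respect to `ρ`,
where `b θ = log ∫ exp (θ x) dρ(x)`. -/
def expFamily (ρ : Measure ℝ) (θ : ℝ) : Measure ℝ := ρ.tilted (fun x => θ * x)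

/-- The mean of `P_θ`. -/
def meanOf (ρ : Measure ℝ) (θ : ℝ) : ℝ := ∫ x, x ∂(expFamily ρ θ)

/-- The set of the means of the members of the family. -/
def meanSpace (ρ : Measure ℝ) : Set ℝ := meanOf ρ '' natParams ρ

/-- The natural parameter of the member with mean `m` (for `m ∈ meanSpace ρ`). -/
def paramOfMean (ρ : Measure ℝ) (m : ℝ) : ℝ :=
  Function.invFunOn (meanOf ρ) (natParams ρ) m

/-- `KL(P, Q)` for the members `P`, `Q` of the family with means `x`, `q`. -/
def klMember (ρ : Measure ℝ) (x q : ℝ) : ℝ≥0∞ :=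
  InformationTheory.klDiv (expFamily ρ (paramOfMean ρ x)) (expFamily ρ (paramOfMean ρ q))

open Classical in
/-- `KL(x, q)` as a function of two means. If both are means of members it is the divergence of
these members. An empirical mean `x`, and the end points of the range of `q`, may also lie on the
boundary of the mean space (as `0` and `1` do for Bernoulli laws), where `KL` is extended by
lower semicontinuity; it is `∞` when `x` or `q` is outside the closure of the mean space. -/
def klMean (ρ : Measure ℝ) (x q : ℝ) : ℝ≥0∞ :=
  if x ∈ meanSpace ρ ∧ q ∈ meanSpace ρ then klMember ρ x q
  else liminf (fun p : ℝ × ℝ => klMember ρ p.1 p.2) (𝓝[meanSpace ρ ×ˢ meanSpace ρ] (x, q))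

/-! ### Upper confidence bounds -/

/-- `sup {q ∈ I | KL(m, q) ≤ δ}`, in the extended reals, so that the supremum of the empty set
is `-∞`. -/
def klSup (ρ : Measure ℝ) (I : Set ℝ) (m δ : ℝ) : EReal :=
  sSup ((fun q : ℝ => (q : EReal)) '' {q | q ∈ I ∧ klMean ρ m q ≤ ENNReal.ofReal δ})

/-- The upper confidence bound of an arm as a function of the horizon `T`, the number `t` of
rounds played so far, the number `n` of pulls of the arm and its empirical mean `m`. -/
abbrev UCBIndex : Type := ℕ → ℕ → ℕ → ℝ → EReal

/-- MOSS. -/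
def mossIndex (K : ℕ) : UCBIndex := fun T _ n m =>
  ((m + √(max 0 (Real.log (((T : ℝ) / K) / n)) / n) : ℝ) : EReal)

/-- KL-MOSS. -/
def klMossIndex (ρ : Measure ℝ) (I : Set ℝ) : UCBIndex := fun T _ n m =>
  klSup ρ I m (Real.posLog ((T : ℝ) / n) / n)

/-- The exploration function of KL-UCB++. -/
def hPlusPlus (K T n : ℕ) : ℝ :=
  Real.posLog ((((T : ℝ) / K) / n) * (Real.posLog (((T : ℝ) / K) / n)) ^ 2 + 1)

/-- KL-UCB++. -/
def klUcbPlusPlusIndex (K : ℕ) (ρ : Measure ℝ) (I : Set ℝ) : UCBIndex := fun T _ n m =>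
  klSup ρ I m (hPlusPlus K T n / n)

/-- KL-UCB-Switch. -/
def klUcbSwitchIndex (K : ℕ) (ρ : Measure ℝ) (I : Set ℝ) : UCBIndex := fun T t n m =>
  if n ≤ ⌊((T : ℝ) / K) ^ ((1 : ℝ) / 5)⌋₊ then klMossIndex ρ I T t n m else mossIndex K T t n m

/-- The exploration function of Anytime-KL-UCB-Switch. -/
def phi (x : ℝ) : ℝ := Real.posLog x * (1 + (Real.posLog x) ^ 2)

/-- Anytime-KL-UCB-Switch; the horizon is not used. -/
def anytimeKlUcbSwitchIndex (K : ℕ) (ρ : Measure ℝ) (I : Set ℝ) : UCBIndex := fun _ t n m =>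
  if n ≤ ⌊((t : ℝ) / K) ^ ((1 : ℝ) / 5)⌋₊ then klSup ρ I m (phi ((t : ℝ) / (K * n)) / n)
  else ((m + √(1 / (2 * (n : ℝ)) * phi ((t : ℝ) / (K * n))) : ℝ) : EReal)

/-- The four algorithms. -/
inductive KLAlgorithm : Type
  | klMoss
  | klUcbPlusPlus
  | klUcbSwitch
  | anytimeKlUcbSwitch

/-- The upper confidence bound that each algorithm uses. -/
def KLAlgorithm.index (alg : KLAlgorithm) (K : ℕ) (ρ : Measure ℝ) (I : Set ℝ) : UCBIndex :=
  match alg with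
  | .klMoss => klMossIndex ρ I
  | .klUcbPlusPlus => klUcbPlusPlusIndex K ρ I
  | .klUcbSwitch => klUcbSwitchIndex K ρ I
  | .anytimeKlUcbSwitch => anytimeKlUcbSwitchIndex K ρ I

/-! ### Runs of an optimism-based rule, and stability -/

/-- The number of pulls of arm `a` in the first `t` rounds; `A s` is the arm pulled in round
`s + 1`. -/
def pulls {K : ℕ} (A : ℕ → Fin K) (a : Fin K) (t : ℕ) : ℕ :=
  ((Finset.range t).filter (fun s => A s = a)).card

/-- The mean of the first `n` rewards of an arm. -/
def empMean (x : ℕ → ℝ) (n : ℕ) : ℝ := (∑ i ∈ Finset.range n, x i) / n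

/-- The value of the upper confidence bound of arm `a` after `t` rounds, with horizon `T`, when
`x a i` is the reward of the `(i + 1)`-st pull of arm `a` and the arms `A` are pulled. -/
def ucbAt {K : ℕ} (U : UCBIndex) (T : ℕ) (x : Fin K → ℕ → ℝ) (A : ℕ → Fin K) (t : ℕ)
    (a : Fin K) : EReal :=
  U T t (pulls A a t) (empMean (x a) (pulls A a t))

/-- `A` is a sequence of pulls that the optimism rule with upper confidence bound `U` can make
within horizon `T`: the first `K` rounds pull each arm once, and then the arm of each round
maximizes the upper confidence bound of the preceding rounds, ties being broken arbitrarily. -/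
def IsRun {K : ℕ} (U : UCBIndex) (T : ℕ) (x : Fin K → ℕ → ℝ) (A : ℕ → Fin K) : Prop :=
  ∀ t < T, (t < K → pulls A (A t) t = 0) ∧
    (K ≤ t → ∀ b : Fin K, ucbAt U T x A t b ≤ ucbAt U T x A t (A t))

/-- Stability of the numbers of pulls: `N a T` is the number of pulls of arm `a` up to time `T`,
and for each arm there are nonrandom `s T → ∞` with `N a T / s T → 1` in probability. -/
def IsStable {K : ℕ} {Ω : Type*} [MeasurableSpace Ω] (P : Measure Ω)
    (N : Fin K → ℕ → Ω → ℕ) : Prop :=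
  ∀ a : Fin K, ∃ s : ℕ → ℝ, Tendsto s atTop atTop ∧
    TendstoInMeasure P (fun T ω => (N a T ω : ℝ) / s T) atTop (fun _ => (1 : ℝ))

end

end KLBandit

namespace KLBandit

/-! Write `a` for the common mean. The heart of the proof is that every arm `j` has at most about `T
/ (2K)` pulls with probability bounded away from zero (`exists_pos_le_measure_pulls_le`). Stability
would make the count of arm `j` nearly deterministic, hence at most a little above `T / (2K)` with
high probability. This would hold for all arms at once, whereas the counts add up to `T`
(`not_isStable_of_le_measure`). Proving the bound for every arm avoids any appeal to
exchangeability, which arbitrary tie-breaking would destroy.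

The bound for arm `j` comes from an event on the rewards alone. First, after `n₀ = pullBound K T`
pulls the empirical mean of arm `j` is below `a - y / √n₀`, with `y` large; the central limit
theorem gives this positive probability. As `n₀` is of order `T`, all exploration terms are then
`O(1 / √n₀)`, by the quadratic lower bound on the divergence (`index_le_coe`), and the index of arm
`j` is below `a - b D / √T`. Second, the reward sequences of the other arms lie in `goodSet`, which
keeps their indices above this level whatever their numbers of pulls (`eventually_coe_le_index`).
Thus arm `j` is never pulled again (`IsRun.pulls_le_of_index_lt`). The rows of rewards are
independent, so the probabilities multiply.

A good sequence has two phases. Up to `T / D` pulls the deviation stays below a small multiple of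
the exploration bonus. Near `a` the divergence is at most `C (m - a)²` (`exists_klMean_le_sq`), so
`a` itself is admissible in the supremum. After `T / D` pulls the bonus may vanish, and the index is
only known to dominate the empirical mean `m`, provided that `m ∈ I`. There the sums are kept on the
side of `a` that points into `I`, at distance `O(√T)`. `exists_pos_le_measure_goodSet` bounds the
probability below by dyadic peeling for the first phase and independent blocks for the second. -/

/-! ### Independence of disjoint groups of variables -/

/-- The σ-algebra generated by the variables `Y i` with `i ∈ S`. -/
abbrev sigmaOf {ι Ω : Type*} (Y : ι → Ω → ℝ) (S : Set ι) : MeasurableSpace Ω :=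
  ⨆ i ∈ S, MeasurableSpace.comap (Y i) inferInstance

theorem measurable_sigmaOf {ι Ω : Type*} (Y : ι → Ω → ℝ) {S : Set ι} {i : ι} (hi : i ∈ S) :
    Measurable[sigmaOf Y S] (Y i) :=
  (comap_measurable (Y i)).mono (le_iSup₂_of_le i hi le_rfl) le_rfl

theorem sigmaOf_mono {ι Ω : Type*} (Y : ι → Ω → ℝ) {S S' : Set ι} (h : S ⊆ S') :
    sigmaOf Y S ≤ sigmaOf Y S' :=
  biSup_mono h

theorem sigmaOf_le {ι Ω : Type*} [mΩ : MeasurableSpace Ω] {Y : ι → Ω → ℝ}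
    (hY : ∀ i, Measurable (Y i)) (S : Set ι) : sigmaOf Y S ≤ mΩ :=
  iSup₂_le fun i _ => (hY i).comap_le

theorem measure_inter_of_disjoint {ι Ω : Type*} [MeasurableSpace Ω] {P : Measure Ω}
    {Y : ι → Ω → ℝ} (hY : ∀ i, Measurable (Y i)) (hind : iIndepFun Y P) {S S' : Set ι}
    (hd : Disjoint S S') {E E' : Set Ω} (hE : MeasurableSet[sigmaOf Y S] E)
    (hE' : MeasurableSet[sigmaOf Y S'] E') : P (E ∩ E') = P E * P E' :=
  (Indep_iff _ _ _).1 (indep_iSup_of_disjoint (fun i => (hY i).comap_le) hind hd) E E' hE hE'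

/-! ### The maximal inequality for sums of sub-Gaussian variables -/

theorem measurable_sum_sigmaOf {ι Ω : Type*} (Y : ι → Ω → ℝ) {S : Set ι} {f : ℕ → ι} {n : ℕ}
    (h : ∀ i < n, f i ∈ S) : Measurable[sigmaOf Y S] (fun ω => ∑ i ∈ Finset.range n, Y (f i) ω) :=
  Finset.measurable_fun_sum _ fun i hi => measurable_sigmaOf Y (h i (Finset.mem_range.1 hi))

theorem one_le_mgf {Ω : Type*} [MeasurableSpace Ω] {P : Measure Ω} [IsProbabilityMeasure P]
    {Z : Ω → ℝ} (hZ : HasSubgaussianMGF Z 1 P) (h0 : ∫ ω, Z ω ∂P = 0) (l : ℝ) :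
    1 ≤ ∫ ω, Real.exp (l * Z ω) ∂P := by
  have h1 : ∫ ω, (1 + l * Z ω) ∂P = 1 := by
    rw [integral_add (integrable_const _) (hZ.integrable.const_mul l), integral_const_mul, h0]
    simp
  rw [← h1]
  refine integral_mono ((integrable_const _).add (hZ.integrable.const_mul l))
    (hZ.integrable_exp_mul l) fun ω => ?_
  have := Real.add_one_le_exp (l * Z ω)
  simp only; linarith

/-- Each new factor is independent of the past and has expectation at least `1`, by `1 + u ≤ exp u`
and centring. -/
theorem submartingale_exp_sum {Ω : Type*} [mΩ : MeasurableSpace Ω] {P : Measure Ω}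
    [IsProbabilityMeasure P] {Y : ℕ → Ω → ℝ} (hY : ∀ i, Measurable (Y i)) (hind : iIndepFun Y P)
    (hsub : ∀ i, HasSubgaussianMGF (Y i) 1 P) (h0 : ∀ i, ∫ ω, Y i ω ∂P = 0) (l : ℝ) :
    Submartingale (fun n ω => Real.exp (l * ∑ i ∈ Finset.range n, Y i ω))
      (⟨fun n => sigmaOf Y (Set.Iio n), fun _ _ h => sigmaOf_mono Y (Set.Iio_subset_Iio h),
        fun _ => sigmaOf_le hY _⟩ : Filtration ℕ mΩ) P := by
  have hmeas : ∀ n, Measurable[sigmaOf Y (Set.Iio n)]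
      (fun ω => Real.exp (l * ∑ i ∈ Finset.range n, Y i ω)) := fun n =>
    Real.measurable_exp.comp
      ((measurable_sum_sigmaOf Y (f := id) (fun i hi => hi)).const_mul l)
  have hint : ∀ n, Integrable (fun ω => Real.exp (l * ∑ i ∈ Finset.range n, Y i ω)) P := by
    intro n
    have := (HasSubgaussianMGF.sum_of_iIndepFun hind (c := fun _ => 1) (s := Finset.range n)
      fun i _ => hsub i).integrable_exp_mul l
    simpa using this
  refine submartingale_nat (fun n => (hmeas n).stronglyMeasurable) hint fun n => ?_
  have hle := sigmaOf_le hY (Set.Iio n)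
  have hstep : (fun ω => Real.exp (l * ∑ i ∈ Finset.range (n + 1), Y i ω)) =
      (fun ω => Real.exp (l * ∑ i ∈ Finset.range n, Y i ω)) * fun ω => Real.exp (l * Y n ω) := by
    ext ω
    simp only [Pi.mul_apply, Finset.sum_range_succ, mul_add, Real.exp_add]
  have hcond : P[fun ω => Real.exp (l * Y n ω) | sigmaOf Y (Set.Iio n)] =ᵐ[P]
      fun _ => ∫ ω, Real.exp (l * Y n ω) ∂P := by
    refine condExp_indep_eq (m₁ := sigmaOf Y {n}) (sigmaOf_le hY _) hle ?_ ?_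
    · exact (Real.measurable_exp.comp
        ((measurable_sigmaOf Y (Set.mem_singleton n)).const_mul l)).stronglyMeasurable
    · exact indep_iSup_of_disjoint (fun i => (hY i).comap_le) hind (by simp)
  have hprod := condExp_mul_of_stronglyMeasurable_left (μ := P) (hmeas n).stronglyMeasurable
    (hstep ▸ hint (n + 1)) ((hsub n).integrable_exp_mul l)
  change (fun ω => Real.exp (l * ∑ i ∈ Finset.range n, Y i ω)) ≤ᵐ[P]
    P[fun ω => Real.exp (l * ∑ i ∈ Finset.range (n + 1), Y i ω) | sigmaOf Y (Set.Iio n)]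
  rw [hstep]
  filter_upwards [hcond, hprod] with ω h1 h2
  rw [h2, Pi.mul_apply, h1]
  exact le_mul_of_one_le_right (Real.exp_pos _).le (one_le_mgf (hsub n) (h0 n) l)

theorem measure_exists_le_sum {Ω : Type*} [mΩ : MeasurableSpace Ω] {P : Measure Ω}
    [IsProbabilityMeasure P] {Y : ℕ → Ω → ℝ} (hY : ∀ i, Measurable (Y i)) (hind : iIndepFun Y P)
    (hsub : ∀ i, HasSubgaussianMGF (Y i) 1 P) (h0 : ∀ i, ∫ ω, Y i ω ∂P = 0) {n : ℕ} (hn : 0 < n)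
    {a : ℝ} (ha : 0 ≤ a) :
    P.real {ω | ∃ k ≤ n, a ≤ ∑ i ∈ Finset.range k, Y i ω} ≤ Real.exp (-(a ^ 2 / (2 * n))) := by
  have hn' : (0 : ℝ) < n := by exact_mod_cast hn
  -- This choice minimizes the Chernoff exponent `n l² / 2 - l a`.
  set l : ℝ := a / n with hl
  have hl0 : 0 ≤ l := by positivity
  set ε : NNReal := ⟨Real.exp (l * a), (Real.exp_pos _).le⟩ with hε
  have hmax := maximal_ineq (submartingale_exp_sum hY hind hsub h0 l)
    (fun _ ω => (Real.exp_pos _).le) (ε := ε) n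
  set A := {ω | (ε : ℝ) ≤ (Finset.range (n + 1)).sup' Finset.nonempty_range_add_one
    fun k => Real.exp (l * ∑ i ∈ Finset.range k, Y i ω)} with hA
  have hsubset : {ω | ∃ k ≤ n, a ≤ ∑ i ∈ Finset.range k, Y i ω} ⊆ A := by
    rintro ω ⟨k, hk, hak⟩
    have h := Finset.le_sup' (fun k => Real.exp (l * ∑ i ∈ Finset.range k, Y i ω))
      (Finset.mem_range.2 (Nat.lt_succ_of_le hk))
    exact (Real.exp_le_exp.2 (mul_le_mul_of_nonneg_left hak hl0)).trans h
  have hsg : HasSubgaussianMGF (fun ω => ∑ i ∈ Finset.range n, Y i ω) n P := by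
    have := HasSubgaussianMGF.sum_of_iIndepFun hind (c := fun _ => 1) (s := Finset.range n)
      fun i _ => hsub i
    simpa using this
  have hint : ∫ ω in A, Real.exp (l * ∑ i ∈ Finset.range n, Y i ω) ∂P ≤
      Real.exp (n * l ^ 2 / 2) :=
    (setIntegral_le_integral (hsg.integrable_exp_mul l)
      (ae_of_all _ fun ω => (Real.exp_pos _).le)).trans (by simpa [mgf] using hsg.mgf_le l)
  have h2 : Real.exp (l * a) * P.real A ≤ Real.exp (n * l ^ 2 / 2) := by
    have := ENNReal.toReal_mono ENNReal.ofReal_ne_top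
      (hmax.trans (ENNReal.ofReal_le_ofReal hint))
    rwa [ENNReal.toReal_mul, ENNReal.toReal_ofReal (Real.exp_pos _).le] at this
  have h3 : P.real A ≤ Real.exp (n * l ^ 2 / 2 - l * a) := by
    rw [Real.exp_sub, le_div_iff₀ (Real.exp_pos _)]; linarith
  refine (measureReal_mono hsubset).trans (h3.trans (le_of_eq ?_))
  congr 1
  rw [hl]; field_simp; ring

theorem measure_exists_le_abs_sum {Ω : Type*} [mΩ : MeasurableSpace Ω] {P : Measure Ω}
    [IsProbabilityMeasure P] {Y : ℕ → Ω → ℝ} (hY : ∀ i, Measurable (Y i)) (hind : iIndepFun Y P)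
    (hsub : ∀ i, HasSubgaussianMGF (Y i) 1 P) (h0 : ∀ i, ∫ ω, Y i ω ∂P = 0) {n : ℕ} (hn : 0 < n)
    {a : ℝ} (ha : 0 ≤ a) :
    P.real {ω | ∃ k ≤ n, a ≤ |∑ i ∈ Finset.range k, Y i ω|} ≤
      2 * Real.exp (-(a ^ 2 / (2 * n))) := by
  have h1 := measure_exists_le_sum hY hind hsub h0 hn ha
  have h2 := measure_exists_le_sum (Y := fun i ω => -Y i ω) (fun i => (hY i).neg)
    (hind.comp (fun _ x => -x) fun _ => measurable_neg) (fun i => (hsub i).neg)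
    (fun i => by rw [integral_neg, h0, neg_zero]) hn ha
  have hU : {ω | ∃ k ≤ n, a ≤ |∑ i ∈ Finset.range k, Y i ω|} ⊆
      {ω | ∃ k ≤ n, a ≤ ∑ i ∈ Finset.range k, Y i ω} ∪
      {ω | ∃ k ≤ n, a ≤ ∑ i ∈ Finset.range k, -Y i ω} := by
    rintro ω ⟨k, hk, hak⟩
    rcases le_abs.1 hak with h | h
    · exact Or.inl ⟨k, hk, h⟩
    · exact Or.inr ⟨k, hk, by rwa [Finset.sum_neg_distrib]⟩
  refine (measureReal_mono hU).trans ((measureReal_union_le _ _).trans ?_)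
  linarith

/-! ### The central limit theorem, as a lower bound for the upper tail -/

/-- The limit law is a nondegenerate Gaussian, which charges the open set `(y, ∞)`; the portmanteau
inequality for open sets transfers this to large `n`. -/
theorem exists_pos_le_measure_sum {Ω : Type*} [mΩ : MeasurableSpace Ω] {P : Measure Ω}
    [IsProbabilityMeasure P] {Y : ℕ → Ω → ℝ} (hY : ∀ i, Measurable (Y i)) (hind : iIndepFun Y P)
    (hid : ∀ i, IdentDistrib (Y i) (Y 0) P P) (hL2 : MemLp (Y 0) 2 P) (h0 : ∫ ω, Y 0 ω ∂P = 0)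
    (hvar : 0 < variance (Y 0) P) (y : ℝ) :
    ∃ p : ℝ, 0 < p ∧ ∃ N : ℕ, ∀ n, N ≤ n →
      p ≤ P.real {ω | y * √n ≤ ∑ i ∈ Finset.range n, Y i ω} := by
  set v := (variance (Y 0) P).toNNReal with hv
  have hv0 : v ≠ 0 := by simpa [hv] using hvar
  have hclt := tendstoInDistribution_inv_sqrt_mul_sum_sub (P := P) (X := Y)
    (P' := gaussianReal 0 v) (Y := id) ⟨aemeasurable_id, by simp [hv]⟩ hL2 hind hid
  have hpos : 0 < gaussianReal 0 v (Set.Ioi y) := by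
    have := gaussianReal_absolutelyContinuous' 0 hv0
    refine pos_iff_ne_zero.2 fun h => ?_
    simpa using this h
  obtain ⟨q, hq0, hq⟩ := ENNReal.lt_iff_exists_real_btwn.1 hpos
  have hq0' : 0 < q := by
    simpa using hq.1
  have hport := ProbabilityMeasure.le_liminf_measure_open_of_tendsto hclt.tendsto
    (isOpen_Ioi (a := y))
  simp only [ProbabilityMeasure.coe_mk, Measure.map_id] at hport
  have hev := eventually_lt_of_lt_liminf (hq.2.trans_le hport)
  obtain ⟨N, hN⟩ := eventually_atTop.1 hev
  refine ⟨q, hq0', max N 1, fun n hn => ?_⟩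
  have h1 := hN n ((le_max_left _ _).trans hn)
  have hn1 : (0 : ℝ) < n := by exact_mod_cast (le_max_right N 1).trans hn
  rw [Measure.map_apply (by fun_prop) measurableSet_Ioi] at h1
  have h2 : q ≤ P.real ((fun ω => (√n)⁻¹ * (∑ k ∈ Finset.range n, Y k ω - n * ∫ ω, Y 0 ω ∂P)) ⁻¹'
      Set.Ioi y) := by
    rw [measureReal_def, ← ENNReal.ofReal_le_iff_le_toReal (measure_ne_top _ _)]
    exact h1.le
  refine h2.trans (measureReal_mono fun ω hω => ?_)
  simp only [Set.mem_preimage, Set.mem_Ioi, h0, mul_zero, sub_zero] at hω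
  have hs : 0 < √(n : ℝ) := Real.sqrt_pos.2 hn1
  rw [inv_mul_eq_div, lt_div_iff₀ hs] at hω
  exact hω.le

/-! ### Sequences of independent variables with a common law -/

/-- The sum of the first `n` terms of a sequence. -/
abbrev psum (x : ℕ → ℝ) (n : ℕ) : ℝ := ∑ i ∈ Finset.range n, x i

/-- The law of a sequence of independent variables with law `ν`. -/
noncomputable abbrev iidLaw (ν : Measure ℝ) [IsProbabilityMeasure ν] : Measure (ℕ → ℝ) :=
  Measure.infinitePi fun _ => ν

theorem map_eq_iidLaw {Ω : Type*} [MeasurableSpace Ω] {P : Measure Ω} {ν : Measure ℝ}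
    [IsProbabilityMeasure ν] {Y : ℕ → Ω → ℝ} (hY : ∀ i, Measurable (Y i)) (hind : iIndepFun Y P)
    (hlaw : ∀ i, P.map (Y i) = ν) : P.map (fun ω i => Y i ω) = iidLaw ν := by
  rw [hind.map_fun_eq_infinitePi_map hY]
  congr 1
  ext1 i
  exact hlaw i

/-- Moves probabilities of path events to the canonical sequence space, where one bound serves all
arms. -/
theorem measureReal_seq_eq {Ω : Type*} [MeasurableSpace Ω] {P : Measure Ω} {ν : Measure ℝ}
    [IsProbabilityMeasure ν] {Y : ℕ → Ω → ℝ} (hY : ∀ i, Measurable (Y i)) (hind : iIndepFun Y P)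
    (hlaw : ∀ i, P.map (Y i) = ν) {B : Set (ℕ → ℝ)} (hB : MeasurableSet B) :
    P.real {ω | (fun i => Y i ω) ∈ B} = (iidLaw ν).real B := by
  rw [← map_eq_iidLaw hY hind hlaw, measureReal_def, measureReal_def,
    Measure.map_apply (measurable_pi_iff.2 hY) hB]
  rfl

/-- The coordinates on the space of sequences. -/
abbrev coord (i : ℕ) (x : ℕ → ℝ) : ℝ := x i

theorem measurable_coord (i : ℕ) : Measurable (coord i) := measurable_pi_apply i

theorem iIndepFun_coord (ν : Measure ℝ) [IsProbabilityMeasure ν] :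
    iIndepFun coord (iidLaw ν) :=
  iIndepFun_infinitePi (X := fun _ x => x) fun _ => measurable_id

theorem map_coord (ν : Measure ℝ) [IsProbabilityMeasure ν] (i : ℕ) :
    (iidLaw ν).map (coord i) = ν :=
  Measure.infinitePi_map_eval _ i

theorem measureReal_shift (ν : Measure ℝ) [IsProbabilityMeasure ν] (k : ℕ) {B : Set (ℕ → ℝ)}
    (hB : MeasurableSet B) :
    (iidLaw ν).real {x | (fun i => x (k + i)) ∈ B} = (iidLaw ν).real B :=
  measureReal_seq_eq (Y := fun i (x : ℕ → ℝ) => x (k + i)) (fun i => measurable_coord (k + i))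
    ((iIndepFun_coord ν).precomp (add_right_injective k)) (fun i => map_coord ν (k + i)) hB

theorem hasSubgaussianMGF_coord {ν : Measure ℝ} [IsProbabilityMeasure ν]
    (hsub : HasSubgaussianMGF id 1 ν) (i : ℕ) : HasSubgaussianMGF (coord i) 1 (iidLaw ν) :=
  hsub.congr_identDistrib ⟨aemeasurable_id, (measurable_coord i).aemeasurable, by
    rw [map_coord, Measure.map_id]⟩

theorem integral_coord {ν : Measure ℝ} [IsProbabilityMeasure ν] (h0 : ∫ x, x ∂ν = 0) (i : ℕ) :
    ∫ x, coord i x ∂(iidLaw ν) = 0 := by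
  rw [← h0]
  nth_rewrite 2 [← map_coord ν i]
  exact (integral_map (measurable_coord i).aemeasurable aestronglyMeasurable_id).symm

theorem measure_exists_le_abs_psum {ν : Measure ℝ} [IsProbabilityMeasure ν]
    (hsub : HasSubgaussianMGF id 1 ν) (h0 : ∫ x, x ∂ν = 0) {n : ℕ} (hn : 0 < n) {a : ℝ}
    (ha : 0 ≤ a) :
    (iidLaw ν).real {x | ∃ k ≤ n, a ≤ |psum x k|} ≤ 2 * Real.exp (-(a ^ 2 / (2 * n))) :=
  measure_exists_le_abs_sum measurable_coord (iIndepFun_coord ν) (hasSubgaussianMGF_coord hsub)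
    (integral_coord h0) hn ha

theorem exists_pos_le_measure_psum {ν : Measure ℝ} [IsProbabilityMeasure ν]
    (hsub : HasSubgaussianMGF id 1 ν) (h0 : ∫ x, x ∂ν = 0) (hvar : 0 < variance id ν) (y : ℝ) :
    ∃ p : ℝ, 0 < p ∧ ∃ N : ℕ, ∀ n, N ≤ n → p ≤ (iidLaw ν).real {x | y * √n ≤ psum x n} := by
  have hid : ∀ i, IdentDistrib (coord i) (coord 0) (iidLaw ν) (iidLaw ν) := fun i =>
    ⟨(measurable_coord i).aemeasurable, (measurable_coord 0).aemeasurable, by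
      rw [map_coord, map_coord]⟩
  have hid' : IdentDistrib id (coord 0) ν (iidLaw ν) :=
    ⟨aemeasurable_id, (measurable_coord 0).aemeasurable, by rw [map_coord, Measure.map_id]⟩
  exact exists_pos_le_measure_sum measurable_coord (iIndepFun_coord ν) hid
    ((hasSubgaussianMGF_coord hsub 0).memLp 2) (integral_coord h0 0)
    (by rwa [← hid'.variance_eq]) y

theorem measurable_psum_coord {S : Set ℕ} {n : ℕ} (h : ∀ i < n, i ∈ S) :
    Measurable[sigmaOf coord S] (fun x => psum x n) :=
  measurable_sum_sigmaOf coord (f := id) h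

theorem measurable_psum (n : ℕ) : Measurable (fun x => psum x n) :=
  (measurable_psum_coord (S := Set.univ) fun _ _ => trivial).mono
    (sigmaOf_le measurable_coord _) le_rfl

/-! ### Staying below the boundary `√(κ n log (T / (L n)))` -/

/-- The sequences whose partial sums stay below the boundary up to time `T / D`. -/
def peelSet (κ L : ℝ) (D T : ℕ) : Set (ℕ → ℝ) :=
  {x | ∀ n, 1 ≤ n → n ≤ T / D → psum x n ^ 2 ≤ κ * n * Real.log (T / (L * n))}

theorem measurableSet_peelSet {S : Set ℕ} (κ L : ℝ) (D T : ℕ) (h : ∀ i < T / D, i ∈ S) :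
    MeasurableSet[sigmaOf coord S] (peelSet κ L D T) := by
  have : peelSet κ L D T = ⋂ n, ⋂ (_ : 1 ≤ n), ⋂ (_ : n ≤ T / D),
      {x | psum x n ^ 2 ≤ κ * n * Real.log (T / (L * n))} := by
    ext x; simp [peelSet]
  rw [this]
  refine MeasurableSet.iInter fun n => MeasurableSet.iInter fun _ => MeasurableSet.iInter fun hn =>
    ?_
  exact ((measurable_psum_coord fun i hi => h i (hi.trans_le hn)).pow_const 2) measurableSet_Iic

/-- Dyadic peeling: for `2 ^ i ≤ n < 2 ^ (i + 1)` the boundary is weakened to a constant level,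
using the left end in the factor `n` and the right end inside the logarithm. -/
theorem compl_peelSet_subset {κ L : ℝ} (hκ : 0 < κ) (hL : 0 < L) {D T : ℕ} (hD0 : 0 < D)
    (hD : 2 * L ≤ D) :
    (peelSet κ L D T)ᶜ ⊆ ⋃ i ∈ Finset.range (Nat.log 2 (T / D) + 1), {x | ∃ k ≤ 2 ^ (i + 1),
      √(κ * 2 ^ i * Real.log (T / (L * 2 ^ (i + 1)))) ≤ |psum x k|} := by
  intro x hx
  simp only [peelSet, Set.mem_compl_iff, Set.mem_ofPred_eq, not_forall, not_le] at hx
  obtain ⟨n, hn1, hnm, hlt⟩ := hx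
  have hm0 : T / D ≠ 0 := by omega
  simp only [Set.mem_iUnion, Finset.mem_range, Nat.lt_succ_iff, Set.mem_ofPred_eq]
  have h1 : (2 : ℝ) ^ Nat.log 2 n ≤ n := by exact_mod_cast Nat.pow_log_le_self 2 (by omega)
  have h2 : n < 2 ^ (Nat.log 2 n + 1) := Nat.lt_pow_succ_log_self (by norm_num) n
  have h2' : (n : ℝ) ≤ 2 ^ (Nat.log 2 n + 1) := by exact_mod_cast h2.le
  refine ⟨Nat.log 2 n, Nat.log_mono_right hnm, n, h2.le, ?_⟩
  have hn0 : (0 : ℝ) < n := by exact_mod_cast hn1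
  have hnT : (n : ℝ) * D ≤ T := by exact_mod_cast (Nat.le_div_iff_mul_le hD0).1 hnm
  have hT0 : (0 : ℝ) < T := lt_of_lt_of_le (mul_pos hn0 (by exact_mod_cast hD0)) hnT
  have hpow : (0 : ℝ) < 2 ^ (Nat.log 2 n + 1) := by positivity
  have hLD : L * n ≤ T := by
    have : L * n ≤ n * D := by rw [mul_comm]; gcongr; linarith
    exact this.trans hnT
  have hlog0 : 0 ≤ Real.log (T / (L * n)) :=
    Real.log_nonneg ((one_le_div (by positivity)).2 hLD)
  have hlog : Real.log (T / (L * 2 ^ (Nat.log 2 n + 1))) ≤ Real.log (T / (L * n)) :=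
    Real.log_le_log (by positivity) (by gcongr)
  rw [← Real.sqrt_sq_eq_abs]
  refine Real.sqrt_le_sqrt (le_trans ?_ hlt.le)
  calc κ * 2 ^ Nat.log 2 n * Real.log (T / (L * 2 ^ (Nat.log 2 n + 1)))
      ≤ κ * 2 ^ Nat.log 2 n * Real.log (T / (L * n)) := by gcongr
    _ ≤ κ * n * Real.log (T / (L * n)) := by gcongr

/-- The maximal inequality bounds the `i`-th dyadic block by `2 (T / (L 2 ^ (i + 1))) ^ (-κ / 4)`.
Counted back from the last block, these bounds decay geometrically, so the total is of order `(D /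
(2L)) ^ (-κ / 4)`, uniformly in `T`. -/
theorem measure_compl_peelSet_le {ν : Measure ℝ} [IsProbabilityMeasure ν]
    (hsub : HasSubgaussianMGF id 1 ν) (h0 : ∫ x, x ∂ν = 0) {κ L : ℝ} (hκ : 0 < κ) (hL : 0 < L)
    {D T : ℕ} (hD0 : 0 < D) (hD : 2 * L ≤ D) :
    (iidLaw ν).real (peelSet κ L D T)ᶜ ≤
      2 * Real.exp (-(κ / 4) * Real.log (D / (2 * L))) *
        (1 - Real.exp (-(κ / 4) * Real.log 2))⁻¹ := by
  set r := Real.exp (-(κ / 4) * Real.log 2) with hr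
  set A := 2 * Real.exp (-(κ / 4) * Real.log (D / (2 * L))) with hA
  have hlog2 : 0 < Real.log 2 := Real.log_pos (by norm_num)
  have hr1 : r < 1 := Real.exp_zero ▸ Real.exp_lt_exp.2 (by nlinarith)
  have hr0 : 0 ≤ r := (Real.exp_pos _).le
  have hDpos : (0 : ℝ) < D := by exact_mod_cast hD0
  by_cases hm : T / D = 0
  · have : (peelSet κ L D T)ᶜ = ∅ := by
      rw [Set.compl_empty_iff, Set.eq_univ_iff_forall]
      intro x n h1 h2
      omega
    rw [this, measureReal_empty]
    have : 0 < 1 - r := by linarith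
    positivity
  set I := Nat.log 2 (T / D) with hI
  have hIT : (2 : ℝ) ^ I * D ≤ T := by
    have h : 2 ^ I ≤ T / D := Nat.pow_log_le_self 2 hm
    exact_mod_cast (Nat.le_div_iff_mul_le hD0).1 h
  have hterm : ∀ i ∈ Finset.range (I + 1), (iidLaw ν).real {x | ∃ k ≤ 2 ^ (i + 1),
      √(κ * 2 ^ i * Real.log (T / (L * 2 ^ (i + 1)))) ≤ |psum x k|} ≤ A * r ^ (I + 1 - 1 - i) := by
    intro i hi
    have hiI : i ≤ I := Nat.lt_succ_iff.1 (Finset.mem_range.1 hi)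
    -- The last block satisfies `2 ^ I * D ≤ T`; each step back from it doubles the argument of the
    -- logarithm.
    have hquot : (D : ℝ) / (2 * L) * 2 ^ (I - i) ≤ T / (L * 2 ^ (i + 1)) := by
      have h2 : (2 : ℝ) ^ I = 2 ^ i * 2 ^ (I - i) := by rw [← pow_add, Nat.add_sub_cancel' hiI]
      rw [div_mul_eq_mul_div, div_le_div_iff₀ (by positivity) (by positivity), pow_succ]
      rw [h2] at hIT
      calc (D : ℝ) * 2 ^ (I - i) * (L * (2 ^ i * 2)) = 2 ^ i * 2 ^ (I - i) * D * (2 * L) := by ring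
        _ ≤ T * (2 * L) := by gcongr
    have hq1 : 1 ≤ (D : ℝ) / (2 * L) := (one_le_div (by positivity)).2 hD
    have hlogle : Real.log (D / (2 * L)) + (I - i : ℕ) * Real.log 2 ≤
        Real.log (T / (L * 2 ^ (i + 1))) := by
      rw [← Real.log_pow, ← Real.log_mul (by positivity) (by positivity)]
      exact Real.log_le_log (by positivity) hquot
    have hlog0 : 0 ≤ Real.log (T / (L * 2 ^ (i + 1))) :=
      le_trans (add_nonneg (Real.log_nonneg hq1) (by positivity)) hlogle
    refine (measure_exists_le_abs_psum hsub h0 (by positivity) (Real.sqrt_nonneg _)).trans ?_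
    rw [hA, hr, ← Real.exp_nat_mul, mul_assoc 2, ← Real.exp_add, Nat.add_sub_cancel,
      Real.sq_sqrt (by positivity)]
    refine mul_le_mul_of_nonneg_left (Real.exp_le_exp.2 ?_) (by norm_num)
    have : κ * 2 ^ i * Real.log (T / (L * 2 ^ (i + 1))) / (2 * (2 ^ (i + 1) : ℕ)) =
        κ / 4 * Real.log (T / (L * 2 ^ (i + 1))) := by
      push_cast; rw [pow_succ]; field_simp; ring
    rw [this]
    nlinarith
  calc (iidLaw ν).real (peelSet κ L D T)ᶜ
      ≤ (iidLaw ν).real (⋃ i ∈ Finset.range (I + 1), {x | ∃ k ≤ 2 ^ (i + 1),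
          √(κ * 2 ^ i * Real.log (T / (L * 2 ^ (i + 1)))) ≤ |psum x k|}) :=
        measureReal_mono (compl_peelSet_subset hκ hL hD0 hD) (measure_ne_top _ _)
    _ ≤ ∑ i ∈ Finset.range (I + 1), A * r ^ (I + 1 - 1 - i) :=
        (measureReal_biUnion_finset_le _ _).trans (Finset.sum_le_sum hterm)
    _ = A * ∑ i ∈ Finset.range (I + 1), r ^ i := by
        rw [← Finset.mul_sum, Finset.sum_range_reflect (fun i => r ^ i)]
    _ ≤ A * (1 - r)⁻¹ := by
        refine mul_le_mul_of_nonneg_left ?_ (by positivity)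
        rw [← tsum_geometric_of_lt_one hr0 hr1]
        exact (summable_geometric_of_lt_one hr0 hr1).sum_le_tsum _ fun i _ => pow_nonneg hr0 i

theorem exists_measure_compl_peelSet_le {ν : Measure ℝ} [IsProbabilityMeasure ν]
    (hsub : HasSubgaussianMGF id 1 ν) (h0 : ∫ x, x ∂ν = 0) {κ L ε : ℝ} (hκ : 0 < κ) (hL : 0 < L)
    (hε : 0 < ε) :
    ∃ D₀ : ℕ, ∀ D ≥ D₀, ∀ T : ℕ, (iidLaw ν).real (peelSet κ L D T)ᶜ ≤ ε := by
  set R := (1 - Real.exp (-(κ / 4) * Real.log 2))⁻¹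
  have hlim : Tendsto (fun D : ℕ => 2 * Real.exp (-(κ / 4) * Real.log (D / (2 * L))) * R) atTop
      (𝓝 (2 * 0 * R)) := by
    refine Tendsto.mul_const _ (Tendsto.const_mul _ (Real.tendsto_exp_atBot.comp ?_))
    exact Tendsto.const_mul_atTop_of_neg (by linarith) (Real.tendsto_log_atTop.comp
      (tendsto_natCast_atTop_atTop.atTop_div_const (by positivity)))
  rw [mul_zero, zero_mul] at hlim
  have hev := (hlim.eventually_le_const hε).and
    ((tendsto_natCast_atTop_atTop.eventually_ge_atTop (2 * L)).and (eventually_gt_atTop 0))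
  obtain ⟨D₀, hD₀⟩ := eventually_atTop.1 hev
  exact ⟨D₀, fun D hD T => (measure_compl_peelSet_le hsub h0 hκ hL (hD₀ D hD).2.2
    (hD₀ D hD).2.1).trans (hD₀ D hD).1⟩

/-! ### Staying nonnegative and of order `√T` between the times `T / D` and `T` -/

/-- The sequences with `ℓ`-th partial sum nonnegative and all previous ones bounded by `h`. -/
def blockSet (l : ℕ) (h : ℝ) : Set (ℕ → ℝ) :=
  {z | 0 ≤ psum z l ∧ ∀ k ≤ l, |psum z k| ≤ h}

theorem measurableSet_blockSet_shift {S : Set ℕ} (s l : ℕ) (h : ℝ) (hS : ∀ i < l, s + i ∈ S) :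
    MeasurableSet[sigmaOf coord S] {x : ℕ → ℝ | (fun i => x (s + i)) ∈ blockSet l h} := by
  have hmeas : ∀ k ≤ l, Measurable[sigmaOf coord S]
      (fun x : ℕ → ℝ => psum (fun i => x (s + i)) k) := fun k hk =>
    measurable_sum_sigmaOf coord (f := fun i => s + i) fun i hi => hS i (hi.trans_le hk)
  have : {x : ℕ → ℝ | (fun i => x (s + i)) ∈ blockSet l h} =
      {x | 0 ≤ psum (fun i => x (s + i)) l} ∩
        ⋂ k, ⋂ (_ : k ≤ l), {x | |psum (fun i => x (s + i)) k| ≤ h} := by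
    ext x; simp [blockSet]
  rw [this]
  refine MeasurableSet.inter (hmeas l le_rfl measurableSet_Ici) ?_
  refine MeasurableSet.iInter fun k => MeasurableSet.iInter fun hk => ?_
  exact (measurable_norm.comp (hmeas k hk)) measurableSet_Iic

theorem measurableSet_blockSet (l : ℕ) (h : ℝ) : MeasurableSet (blockSet l h) := by
  have := sigmaOf_le measurable_coord _ _
    (measurableSet_blockSet_shift (S := Set.univ) 0 l h fun _ _ => trivial)
  simp only [zero_add] at this
  exact this

/-- The central limit theorem gives a nonnegative end value with probability at least `q`. For large
`w`, a fluctuation above `√m` within `m / w` steps has probability at most `2 exp (-w / 2) ≤ q / 2`.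
-/
theorem exists_pos_le_measure_blockSet {ν : Measure ℝ} [IsProbabilityMeasure ν]
    (hsub : HasSubgaussianMGF id 1 ν) (h0 : ∫ x, x ∂ν = 0) (hvar : 0 < variance id ν) :
    ∃ q : ℝ, 0 < q ∧ ∃ w : ℕ, 0 < w ∧ ∃ N : ℕ, ∀ m, N ≤ m →
      q ≤ (iidLaw ν).real (blockSet (m / w) √m) := by
  obtain ⟨q, hq, N, hN⟩ := exists_pos_le_measure_psum hsub h0 hvar 0
  have hlim : Tendsto (fun w : ℕ => 2 * Real.exp (-((w : ℝ) / 2))) atTop (𝓝 (2 * 0)) :=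
    Tendsto.const_mul _ (Real.tendsto_exp_neg_atTop_nhds_zero.comp
      (tendsto_natCast_atTop_atTop.atTop_div_const (by norm_num)))
  rw [mul_zero] at hlim
  obtain ⟨w, hw, hw0⟩ := ((hlim.eventually_le_const (half_pos hq)).and
    (eventually_gt_atTop 0)).exists
  refine ⟨q / 2, half_pos hq, w, hw0, w * (N + 1), fun m hm => ?_⟩
  set l := m / w with hl
  have hlN : N + 1 ≤ l := (Nat.le_div_iff_mul_le hw0).2 (by rwa [mul_comm])
  have hl0 : 0 < l := by omega
  have hlw : (l : ℝ) * w ≤ m := by exact_mod_cast Nat.div_mul_le_self m w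
  have hl0' : (0 : ℝ) < l := by exact_mod_cast hl0
  have h1 := hN l (by omega)
  have h2 := measure_exists_le_abs_psum hsub h0 hl0 (Real.sqrt_nonneg (m : ℝ))
  have h3 : 2 * Real.exp (-(√(m : ℝ) ^ 2 / (2 * l))) ≤ q / 2 := by
    refine le_trans ?_ hw
    rw [Real.sq_sqrt (by positivity)]
    gcongr 2 * Real.exp (-?_)
    rw [div_le_div_iff₀ (by norm_num) (by positivity)]
    nlinarith
  have hcover : {x | 0 * √(l : ℝ) ≤ psum x l} ⊆
      blockSet l √m ∪ {x | ∃ k ≤ l, √(m : ℝ) ≤ |psum x k|} := by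
    intro x hx
    by_cases h : ∃ k ≤ l, √(m : ℝ) ≤ |psum x k|
    · exact Or.inr h
    · push Not at h
      exact Or.inl ⟨by simpa using hx, fun k hk => (h k hk).le⟩
  have h4 := (measureReal_mono hcover).trans (measureReal_union_le (μ := iidLaw ν) _ _)
  linarith

theorem psum_add (x : ℕ → ℝ) (s k : ℕ) : psum x (s + k) = psum x s + psum (fun i => x (s + i)) k :=
  Finset.sum_range_add _ _ _

/-- Partial sums that are at least `h` at time `m` and then follow blocks of length `l`. -/
theorem psum_mem_of_blocks {x : ℕ → ℝ} {m l N : ℕ} {h : ℝ} (hl : 0 < l) (hm : h ≤ psum x m)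
    (hb : ∀ q < N, (fun i => x (m + q * l + i)) ∈ blockSet l h) {n : ℕ} (hmn : m ≤ n)
    (hn : n < m + N * l) : 0 ≤ psum x n ∧ psum x n ≤ psum x m + N * h := by
  -- Block increments are nonnegative, so every block starts at height at least `h`; a dip of at
  -- most `h` inside it cannot reach below `0`.
  have key : ∀ q ≤ N, h ≤ psum x (m + q * l) ∧ psum x (m + q * l) ≤ psum x m + q * h := by
    intro q
    induction q with
    | zero => intro _; simpa using hm
    | succ q ih =>
      intro hq
      obtain ⟨h1, h2⟩ := ih (by omega)
      obtain ⟨h3, h4⟩ := hb q (by omega)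
      have h5 := psum_add x (m + q * l) l
      have h6 := (abs_le.1 (h4 l le_rfl)).2
      have h7 : m + (q + 1) * l = m + q * l + l := by ring
      rw [h7, h5]
      push_cast
      constructor <;> linarith
  set q := (n - m) / l with hq
  set r := (n - m) % l with hr
  have hdm : l * q + r = n - m := Nat.div_add_mod (n - m) l
  have hrl : r < l := Nat.mod_lt _ hl
  have hqN : q < N := by
    rw [hq, Nat.div_lt_iff_lt_mul hl]; omega
  have hn' : n = m + q * l + r := by rw [mul_comm q l]; omega
  obtain ⟨h1, h2⟩ := key q hqN.le
  obtain ⟨h3, h4⟩ := hb q hqN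
  have h5 := abs_le.1 (h4 r hrl.le)
  have h0 : 0 ≤ h := (abs_nonneg _).trans (h4 0 (Nat.zero_le _))
  have h6 : ((q : ℝ) + 1) * h ≤ N * h :=
    mul_le_mul_of_nonneg_right (by exact_mod_cast hqN) h0
  rw [hn', psum_add]
  constructor <;> linarith

/-- The blocks use disjoint sets of coordinates, all at or after `m`, and each is a shifted copy of
the same event. -/
theorem measure_inter_blocks {ν : Measure ℝ} [IsProbabilityMeasure ν] {E : Set (ℕ → ℝ)} {m : ℕ}
    (hE : MeasurableSet[sigmaOf coord (Set.Iio m)] E) (l : ℕ) (h : ℝ) (N : ℕ) :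
    (iidLaw ν).real (E ∩ {x | ∀ q < N, (fun i => x (m + q * l + i)) ∈ blockSet l h}) =
      (iidLaw ν).real E * (iidLaw ν).real (blockSet l h) ^ N := by
  have hmeas : ∀ N, MeasurableSet[sigmaOf coord (Set.Iio (m + N * l))]
      (E ∩ {x | ∀ q < N, (fun i => x (m + q * l + i)) ∈ blockSet l h}) := by
    intro N
    refine MeasurableSet.inter (sigmaOf_mono coord (Set.Iio_subset_Iio (by omega)) _ hE) ?_
    have : {x : ℕ → ℝ | ∀ q < N, (fun i => x (m + q * l + i)) ∈ blockSet l h} =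
        ⋂ q, ⋂ (_ : q < N), {x | (fun i => x (m + q * l + i)) ∈ blockSet l h} := by
      ext x; simp
    rw [this]
    refine MeasurableSet.iInter fun q => MeasurableSet.iInter fun hq =>
      measurableSet_blockSet_shift _ _ _ fun i hi => ?_
    have : (q + 1) * l ≤ N * l := Nat.mul_le_mul_right _ hq
    simp only [Set.mem_Iio]
    nlinarith
  induction N with
  | zero => simp
  | succ N ih =>
    have hsplit : E ∩ {x | ∀ q < N + 1, (fun i => x (m + q * l + i)) ∈ blockSet l h} =
        (E ∩ {x | ∀ q < N, (fun i => x (m + q * l + i)) ∈ blockSet l h}) ∩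
          {x | (fun i => x (m + N * l + i)) ∈ blockSet l h} := by
      ext x
      simp only [Set.mem_inter_iff, Set.mem_ofPred_eq, Nat.lt_succ_iff_lt_or_eq, and_assoc,
        or_imp, forall_and, forall_eq]
    have hind := measure_inter_of_disjoint (P := iidLaw ν) measurable_coord (iIndepFun_coord ν)
      (S := Set.Iio (m + N * l)) (S' := Set.Ici (m + N * l))
      (Set.Iio_disjoint_Ici le_rfl) (hmeas N)
      (measurableSet_blockSet_shift (m + N * l) l h fun i _ => by simp)
    rw [hsplit, measureReal_def, hind, ENNReal.toReal_mul, ← measureReal_def, ← measureReal_def,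
      ih, measureReal_shift ν (m + N * l) (measurableSet_blockSet l h), pow_succ, mul_assoc]

/-- The sequences whose partial sums are below the boundary up to time `T / D`, and between `0`
and `b √T` from then on until time `T`. -/
def goodSet (κ L b : ℝ) (D T : ℕ) : Set (ℕ → ℝ) :=
  peelSet κ L D T ∩ {x | ∀ n, T / D ≤ n → n ≤ T → 0 ≤ psum x n ∧ psum x n ≤ b * √T}

theorem measurableSet_goodSet (κ L b : ℝ) (D T : ℕ) : MeasurableSet (goodSet κ L b D T) := by
  refine MeasurableSet.inter (sigmaOf_le measurable_coord _ _
    (measurableSet_peelSet (S := Set.univ) κ L D T fun _ _ => trivial)) ?_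
  have : {x : ℕ → ℝ | ∀ n, T / D ≤ n → n ≤ T → 0 ≤ psum x n ∧ psum x n ≤ b * √T} =
      ⋂ n, ⋂ (_ : T / D ≤ n), ⋂ (_ : n ≤ T), {x | 0 ≤ psum x n ∧ psum x n ≤ b * √T} := by
    ext x; simp
  rw [this]
  exact MeasurableSet.iInter fun n => MeasurableSet.iInter fun _ => MeasurableSet.iInter fun _ =>
    (measurable_psum n) measurableSet_Icc

/-- At `m = T / D` the sum exceeds `√m` with a probability `p₀` that does not depend on `D`. Hence
`D` can be taken so large that leaving the boundary costs at most `p₀ / 2`. From `m` on, a number of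
blocks that does not depend on `T` carries the path to time `T`. -/
theorem exists_pos_le_measure_goodSet {ν : Measure ℝ} [IsProbabilityMeasure ν]
    (hsub : HasSubgaussianMGF id 1 ν) (h0 : ∫ x, x ∂ν = 0) (hvar : 0 < variance id ν) {κ L : ℝ}
    (hκ : 0 < κ) (hL : 0 < L) (Dmin : ℕ) :
    ∃ D : ℕ, Dmin ≤ D ∧ ∃ b : ℝ, 0 ≤ b ∧ ∃ p : ℝ, 0 < p ∧ ∃ T₀ : ℕ, ∀ T ≥ T₀,
      p ≤ (iidLaw ν).real (goodSet κ L b D T) := by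
  obtain ⟨p₀, hp₀, N₀, hN₀⟩ := exists_pos_le_measure_psum hsub h0 hvar 1
  obtain ⟨q, hq, w, hw, N₁, hN₁⟩ := exists_pos_le_measure_blockSet hsub h0 hvar
  obtain ⟨D₀, hD₀⟩ := exists_measure_compl_peelSet_le hsub h0 hκ hL (half_pos hp₀)
  set D := max (max Dmin D₀) 1 with hD
  have hDpos : 0 < D := lt_of_lt_of_le one_pos (le_max_right _ _)
  -- Enough blocks to pass `T`, since `T < D (m + 1) ≤ 2 D m` and `m < w (l + 1) ≤ 2 w l`.
  set N := 4 * D * w with hN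
  -- The boundary at `n = m`, with `T / (L m) ≤ 2 D / L`, gives `psum x m ≤ √B * √m`.
  set B := max 0 (κ * Real.log (2 * D / L)) with hB
  refine ⟨D, (le_max_left _ _).trans (le_max_left _ _), √B + N, by positivity,
    p₀ / 2 * q ^ N, by positivity, D * (N₀ + N₁ + w + 1), fun T hT => ?_⟩
  set m := T / D with hm
  have hmge : N₀ + N₁ + w + 1 ≤ m := (Nat.le_div_iff_mul_le hDpos).2 (by rwa [mul_comm])
  have hTlt : T < D * (m + 1) := Nat.lt_mul_div_succ T hDpos
  set l := m / w with hl
  have hl0 : 0 < l := Nat.div_pos (by omega) hw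
  have hml : m < w * (l + 1) := Nat.lt_mul_div_succ m hw
  have hTN : T < m + N * l := by
    have h1 : w * (l + 1) ≤ 2 * (w * l) := by nlinarith
    have h2 : D * (m + 1) ≤ D * (2 * m) := Nat.mul_le_mul_left _ (by omega)
    have h3 : D * (2 * m) ≤ D * (4 * (w * l)) := Nat.mul_le_mul_left _ (by omega)
    have h4 : D * (4 * (w * l)) = N * l := by rw [hN]; ring
    omega
  set E : Set (ℕ → ℝ) := peelSet κ L D T ∩ {x | 1 * √(m : ℝ) ≤ psum x m} with hE
  have hEmeas : MeasurableSet[sigmaOf coord (Set.Iio m)] E :=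
    MeasurableSet.inter (measurableSet_peelSet κ L D T fun i hi => hi)
      ((measurable_psum_coord fun i hi => hi) measurableSet_Ici)
  have hEp : p₀ / 2 ≤ (iidLaw ν).real E := by
    have h1 := hN₀ m (by omega)
    have h2 := hD₀ D ((le_max_right _ _).trans (le_max_left _ _)) T
    have h3 : {x | 1 * √(m : ℝ) ≤ psum x m} ⊆ E ∪ (peelSet κ L D T)ᶜ := fun x hx => by
      by_cases h : x ∈ peelSet κ L D T
      · exact Or.inl ⟨h, hx⟩
      · exact Or.inr h
    have h4 := (measureReal_mono h3).trans (measureReal_union_le (μ := iidLaw ν) _ _)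
    linarith
  have hsubset : E ∩ {x | ∀ j < N, (fun i => x (m + j * l + i)) ∈ blockSet l √m} ⊆
      goodSet κ L (√B + N) D T := by
    rintro x ⟨⟨hx1, hx2⟩, hx3⟩
    refine ⟨hx1, fun n hn1 hn2 => ?_⟩
    obtain ⟨h1, h2⟩ := psum_mem_of_blocks hl0 (by simpa using hx2) hx3 hn1 (hn2.trans_lt hTN)
    refine ⟨h1, h2.trans ?_⟩
    have hmT : √(m : ℝ) ≤ √(T : ℝ) := Real.sqrt_le_sqrt (by exact_mod_cast Nat.div_le_self T D)
    have hm0 : (0 : ℝ) < m := by exact_mod_cast (by omega : 0 < m)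
    have h3 : psum x m ≤ √B * √m := by
      rw [← Real.sqrt_mul (le_max_left _ _)]
      refine Real.le_sqrt_of_sq_le ((hx1 m (by omega) le_rfl).trans ?_)
      have hT0 : (0 : ℝ) < T := by exact_mod_cast (by nlinarith : 0 < T)
      have h4 : (T : ℝ) / (L * m) ≤ 2 * D / L := by
        rw [div_le_div_iff₀ (by positivity) hL]
        have : (T : ℝ) ≤ D * (2 * m) := by
          exact_mod_cast hTlt.le.trans (Nat.mul_le_mul_left _ (by omega))
        calc (T : ℝ) * L ≤ D * (2 * m) * L := by gcongr
          _ = 2 * D * (L * m) := by ring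
      calc κ * m * Real.log (T / (L * m)) ≤ κ * m * Real.log (2 * D / L) := by
            gcongr
        _ = κ * Real.log (2 * D / L) * m := by ring
        _ ≤ B * m := by gcongr; exact le_max_right _ _
    calc psum x m + N * √m ≤ √B * √m + N * √m := by linarith
      _ = (√B + N) * √m := by ring
      _ ≤ (√B + N) * √T := by gcongr
  calc p₀ / 2 * q ^ N ≤ (iidLaw ν).real E * (iidLaw ν).real (blockSet l √m) ^ N := by
        gcongr
        exact hN₁ m (by omega)
    _ = _ := (measure_inter_blocks hEmeas l √m N).symm
    _ ≤ _ := measureReal_mono hsubset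

/-! ### Exponential families with at least two members -/

section ExpFamily

variable {ρ : Measure ℝ}

theorem natParams_subset {θ : ℝ} (hθ : θ ∈ natParams ρ) :
    Integrable (fun x => Real.exp (θ * x)) ρ :=
  interior_subset (s := integrableExpSet id ρ) hθ

theorem meanOf_eq_deriv {θ : ℝ} (hθ : θ ∈ natParams ρ) :
    meanOf ρ θ = deriv (cgf id ρ) θ :=
  integral_tilted_mul_self hθ

theorem meanSpace_subsingleton_of_ae_eq {a : ℝ} (h : ∀ᵐ x ∂ρ, x = a) :
    (meanSpace ρ).Subsingleton := by
  have key : ∀ θ ∈ natParams ρ, ∀ θ' ∈ natParams ρ, meanOf ρ θ = meanOf ρ θ' := by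
    by_cases hρ : ρ = 0
    · intro θ _ θ' _
      simp [meanOf, expFamily, hρ]
    · have : NeZero ρ := ⟨hρ⟩
      have : ∀ θ ∈ natParams ρ, meanOf ρ θ = a := by
        intro θ hθ
        have := isProbabilityMeasure_tilted (natParams_subset hθ)
        have h' : ∀ᵐ x ∂(expFamily ρ θ), x = a := (tilted_absolutelyContinuous ρ _).ae_le h
        rw [meanOf, integral_congr_ae h', integral_const]
        simp [expFamily]
      intro θ hθ θ' hθ'
      rw [this θ hθ, this θ' hθ']
  rintro _ ⟨θ, hθ, rfl⟩ _ ⟨θ', hθ', rfl⟩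
  exact key θ hθ θ' hθ'

theorem ne_zero_of_nontrivial (h : (meanSpace ρ).Nontrivial) : ρ ≠ 0 := by
  rintro rfl
  exact h.not_subsingleton (meanSpace_subsingleton_of_ae_eq (a := 0) (by simp))

theorem isProbabilityMeasure_expFamily (h : (meanSpace ρ).Nontrivial) {θ : ℝ}
    (hθ : θ ∈ natParams ρ) : IsProbabilityMeasure (expFamily ρ θ) :=
  have : NeZero ρ := ⟨ne_zero_of_nontrivial h⟩
  isProbabilityMeasure_tilted (natParams_subset hθ)

/-- A member of zero variance is a Dirac mass; by mutual absolute continuity `ρ` sits at one point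
too, and there is only one mean. -/
theorem variance_expFamily_pos (h : (meanSpace ρ).Nontrivial) {θ : ℝ}
    (hθ : θ ∈ natParams ρ) : 0 < variance id (expFamily ρ θ) := by
  have := isProbabilityMeasure_expFamily h hθ
  refine lt_of_le_of_ne (variance_nonneg _ _) fun h0 => h.not_subsingleton ?_
  have hL2 : MemLp id 2 (expFamily ρ θ) := memLp_tilted_mul hθ 2
  have h1 := ae_eq_integral_of_variance_eq_zero hL2 h0.symm
  exact meanSpace_subsingleton_of_ae_eq
    ((absolutelyContinuous_tilted (natParams_subset hθ)).ae_le h1)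

/-- The mean is the first derivative of the analytic cumulant generating function, and the variance
is the second. -/
theorem hasStrictDerivAt_meanOf {θ : ℝ} (hθ : θ ∈ natParams ρ) :
    HasStrictDerivAt (meanOf ρ) (variance id (expFamily ρ θ)) θ := by
  have h1 : HasStrictDerivAt (deriv (cgf id ρ)) (deriv (deriv (cgf id ρ)) θ) θ :=
    (analyticAt_cgf hθ).deriv.hasStrictDerivAt
  have h2 : variance id (expFamily ρ θ) = deriv (deriv (cgf id ρ)) θ := by
    rw [← iteratedDeriv_one (f := cgf id ρ), ← iteratedDeriv_succ]
    exact variance_tilted_mul hθ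
  rw [h2]
  refine h1.congr_of_eventuallyEq ?_
  filter_upwards [isOpen_interior.mem_nhds hθ] with t ht using (meanOf_eq_deriv ht).symm

/-- Allows statements about means near `meanOf ρ θ` to be checked on parameters near `θ`. -/
theorem map_meanOf_nhds (h : (meanSpace ρ).Nontrivial) {θ : ℝ} (hθ : θ ∈ natParams ρ) :
    map (meanOf ρ) (𝓝 θ) = 𝓝 (meanOf ρ θ) :=
  (hasStrictDerivAt_meanOf hθ).map_nhds_eq (variance_expFamily_pos h hθ).ne'

theorem convex_natParams (ρ : Measure ℝ) : Convex ℝ (natParams ρ) :=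
  convex_integrableExpSet.interior

theorem continuousOn_meanOf (ρ : Measure ℝ) : ContinuousOn (meanOf ρ) (natParams ρ) := fun _ hθ =>
  (hasStrictDerivAt_meanOf hθ).hasDerivAt.continuousAt.continuousWithinAt

theorem isPreconnected_meanSpace (ρ : Measure ℝ) : IsPreconnected (meanSpace ρ) :=
  (convex_natParams ρ).isPreconnected.image _ (continuousOn_meanOf ρ)

theorem injOn_meanOf (h : (meanSpace ρ).Nontrivial) : Set.InjOn (meanOf ρ) (natParams ρ) := by
  refine (strictMonoOn_of_deriv_pos (convex_natParams ρ) (continuousOn_meanOf ρ)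
    fun θ hθ => ?_).injOn
  have hθ' := interior_subset hθ
  rw [(hasStrictDerivAt_meanOf hθ').hasDerivAt.deriv]
  exact variance_expFamily_pos h hθ'

theorem paramOfMean_meanOf (h : (meanSpace ρ).Nontrivial) {θ : ℝ} (hθ : θ ∈ natParams ρ) :
    paramOfMean ρ (meanOf ρ θ) = θ :=
  (injOn_meanOf h).leftInvOn_invFunOn hθ

theorem klMean_meanOf (h : (meanSpace ρ).Nontrivial) {θ θ' : ℝ} (hθ : θ ∈ natParams ρ)
    (hθ' : θ' ∈ natParams ρ) : klMean ρ (meanOf ρ θ) (meanOf ρ θ') =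
      InformationTheory.klDiv (expFamily ρ θ) (expFamily ρ θ') := by
  rw [klMean, if_pos ⟨Set.mem_image_of_mem _ hθ, Set.mem_image_of_mem _ hθ'⟩, klMember,
    paramOfMean_meanOf h hθ, paramOfMean_meanOf h hθ']

theorem expFamily_eq_tilted {θ θ' : ℝ} (hθ : θ ∈ natParams ρ) :
    expFamily ρ θ' = (expFamily ρ θ).tilted (fun x => (θ' - θ) * x) := by
  rw [expFamily, expFamily, tilted_tilted (natParams_subset hθ)]
  congr 1
  ext x
  simp only [Pi.add_apply]
  ring

theorem klDiv_expFamily (h : (meanSpace ρ).Nontrivial) {θ θ' : ℝ} (hθ : θ ∈ natParams ρ)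
    (hθ' : θ' ∈ natParams ρ) :
    InformationTheory.klDiv (expFamily ρ θ) (expFamily ρ θ') ≠ ∞ ∧
    (InformationTheory.klDiv (expFamily ρ θ) (expFamily ρ θ')).toReal =
      (θ - θ') * meanOf ρ θ + Real.log (∫ x, Real.exp (θ' * x) ∂ρ) -
        Real.log (∫ x, Real.exp (θ * x) ∂ρ) := by
  have := isProbabilityMeasure_expFamily h hθ
  have := isProbabilityMeasure_expFamily h hθ'
  have : NeZero ρ := ⟨ne_zero_of_nontrivial h⟩
  set f : ℝ → ℝ := fun x => (θ' - θ) * x with hf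
  have hac : expFamily ρ θ ≪ expFamily ρ θ' :=
    (tilted_absolutelyContinuous ρ _).trans (absolutelyContinuous_tilted (natParams_subset hθ'))
  have hid : Integrable id (expFamily ρ θ) := by
    have : MemLp id 1 (expFamily ρ θ) := memLp_tilted_mul hθ 1
    exact memLp_one_iff_integrable.1 this
  have hfi : Integrable f (expFamily ρ θ) := hid.const_mul _
  have hexp : Integrable (fun x => Real.exp (f x)) (expFamily ρ θ) := by
    rw [expFamily, integrable_tilted_iff (natParams_subset hθ)]
    refine (natParams_subset hθ').congr (ae_of_all _ fun x => ?_)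
    simp only [smul_eq_mul, hf, ← Real.exp_add]
    congr 1; ring
  have hllr : Integrable (llr (expFamily ρ θ) (expFamily ρ θ)) (expFamily ρ θ) :=
    (integrable_congr (llr_self _)).2 (integrable_zero _ _ _)
  have hint : Integrable (llr (expFamily ρ θ) (expFamily ρ θ')) (expFamily ρ θ) := by
    rw [expFamily_eq_tilted (θ' := θ') hθ]
    exact integrable_llr_tilted_right Measure.AbsolutelyContinuous.rfl hfi hllr hexp
  refine ⟨InformationTheory.klDiv_ne_top hac hint, ?_⟩
  rw [InformationTheory.toReal_klDiv_of_measure_eq hac (by simp)]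
  have hlog : ∫ x, Real.exp (f x) ∂(expFamily ρ θ) =
      (∫ x, Real.exp (θ' * x) ∂ρ) / ∫ x, Real.exp (θ * x) ∂ρ := by
    rw [expFamily, integral_exp_tilted]
    congr 2
    ext x
    simp only [Pi.add_apply, hf]
    congr 1; ring
  have h1 := integral_llr_tilted_right Measure.AbsolutelyContinuous.rfl hfi hexp hllr
  rw [← expFamily_eq_tilted hθ, integral_congr_ae (llr_self _), hlog,
    Real.log_div (integral_exp_pos (natParams_subset hθ')).ne'
      (integral_exp_pos (natParams_subset hθ)).ne', hf, integral_const_mul] at h1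
  rw [h1, meanOf]
  simp only [Pi.zero_apply, integral_zero]
  ring

/-- The right side is the symmetrized divergence: the log-partition terms cancel in the sum of the
two directions, and the reverse one is nonnegative. -/
theorem klDiv_expFamily_le (h : (meanSpace ρ).Nontrivial) {θ θ' : ℝ} (hθ : θ ∈ natParams ρ)
    (hθ' : θ' ∈ natParams ρ) :
    InformationTheory.klDiv (expFamily ρ θ) (expFamily ρ θ') ≤
      ENNReal.ofReal ((θ - θ') * (meanOf ρ θ - meanOf ρ θ')) := by
  obtain ⟨h1, h2⟩ := klDiv_expFamily h hθ hθ'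
  obtain ⟨-, h3⟩ := klDiv_expFamily h hθ' hθ
  rw [← ENNReal.ofReal_toReal h1]
  refine ENNReal.ofReal_le_ofReal ?_
  have h4 : 0 ≤ (InformationTheory.klDiv (expFamily ρ θ') (expFamily ρ θ)).toReal :=
    ENNReal.toReal_nonneg
  rw [h3] at h4
  rw [h2]
  linarith

theorem klMean_self_eq_zero (h : (meanSpace ρ).Nontrivial) {m : ℝ} (hm : m ∈ meanSpace ρ) :
    klMean ρ m m = 0 := by
  obtain ⟨θ, hθ, rfl⟩ := hm
  have := isProbabilityMeasure_expFamily h hθ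
  rw [klMean_meanOf h hθ hθ, InformationTheory.klDiv_self]

theorem meanSpace_mem_nhds (h : (meanSpace ρ).Nontrivial) {m : ℝ} (hm : m ∈ meanSpace ρ) :
    meanSpace ρ ∈ 𝓝 m := by
  obtain ⟨θ, hθ, rfl⟩ := hm
  rw [← map_meanOf_nhds h hθ]
  exact image_mem_map (isOpen_interior.mem_nhds hθ)

/-- Near `q` the mean map expands parameter differences by at least `v / 2`, where `v` is the
variance at `q`. The symmetrized divergence `(θ - θ') (m - q)` is therefore at most `(2 / v) (m -
q)²`. -/
theorem exists_klMean_le_sq (h : (meanSpace ρ).Nontrivial) {q : ℝ} (hq : q ∈ meanSpace ρ) :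
    ∃ C : ℝ, 0 < C ∧ ∀ᶠ m in 𝓝 q, klMean ρ m q ≤ ENNReal.ofReal (C * (m - q) ^ 2) := by
  obtain ⟨θ', hθ', rfl⟩ := hq
  have hv := variance_expFamily_pos h hθ'
  set v := variance id (expFamily ρ θ') with hv_def
  refine ⟨2 / v, by positivity, ?_⟩
  rw [← map_meanOf_nhds h hθ', eventually_map]
  have hder := (hasStrictDerivAt_meanOf hθ').hasDerivAt.isLittleO.def (half_pos hv)
  filter_upwards [hder, isOpen_interior.mem_nhds hθ'] with θ h1 hθ
  rw [klMean_meanOf h hθ hθ']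
  refine (klDiv_expFamily_le h hθ hθ').trans (ENNReal.ofReal_le_ofReal ?_)
  simp only [smul_eq_mul, Real.norm_eq_abs] at h1
  set d := meanOf ρ θ - meanOf ρ θ'
  set e := θ - θ'
  have h2 : v / 2 * |e| ≤ |d| := by
    have h3 := abs_sub_abs_le_abs_sub (e * v) d
    rw [abs_mul, abs_of_pos hv, abs_sub_comm (e * v)] at h3
    linarith
  rw [div_mul_eq_mul_div, le_div_iff₀ hv]
  have h5 : e * d ≤ |e| * |d| := (le_abs_self _).trans (abs_mul _ _).le
  have h6 : d ^ 2 = |d| * |d| := by rw [← sq, sq_abs]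
  rw [h6]
  nlinarith [abs_nonneg d, abs_nonneg e]

/-- The lower limit runs along the trivial filter, where it is `∞`. -/
theorem klMean_eq_top_of_notMem {x q : ℝ} (hx : x ∉ closure (meanSpace ρ)) :
    klMean ρ x q = ∞ := by
  have h1 : x ∉ meanSpace ρ := fun h => hx (subset_closure h)
  have h2 : 𝓝[meanSpace ρ ×ˢ meanSpace ρ] (x, q) = ⊥ := by
    rw [nhdsWithin_prod_eq, notMem_closure_iff_nhdsWithin_eq_bot.1 hx, bot_prod]
  rw [klMean, if_neg (fun h => h1 h.1), h2, liminf_bot]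

/-- The set lies between the interval of means and its closure, hence is an interval. This passes
finiteness of the divergence from single rewards to empirical means. -/
theorem convex_klMean_ne_top (h : (meanSpace ρ).Nontrivial) {q : ℝ} (hq : q ∈ meanSpace ρ) :
    Convex ℝ {x | klMean ρ x q ≠ ∞} := by
  refine (IsPreconnected.subset_closure (isPreconnected_meanSpace ρ) ?_ ?_).ordConnected.convex
  · rintro _ ⟨θ, hθ, rfl⟩
    obtain ⟨θ', hθ', rfl⟩ := hq
    simp only [Set.mem_ofPred_eq]
    rw [klMean_meanOf h hθ hθ']
    exact (klDiv_expFamily h hθ hθ').1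
  · intro x hx
    by_contra hx'
    exact hx (klMean_eq_top_of_notMem hx')

end ExpFamily

/-- A law concentrated on one side of its mean is a Dirac mass. -/
theorem variance_eq_zero_of_ae_le {ν : Measure ℝ} [IsProbabilityMeasure ν]
    (hint : Integrable (fun x : ℝ => x) ν)
    (h : (∀ᵐ x ∂ν, x ≤ ∫ y, y ∂ν) ∨ ∀ᵐ x ∂ν, ∫ y, y ∂ν ≤ x) : variance id ν = 0 := by
  set a := ∫ y, y ∂ν with ha
  have key : ∀ᵐ x ∂ν, x = a := by
    rcases h with h | h
    · have h1 : ∫ x, (a - x) ∂ν = 0 := by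
        rw [integral_sub (integrable_const _) hint]; simp [ha]
      have h2 := (integral_eq_zero_iff_of_nonneg_ae
        (h.mono fun x hx => by simpa using hx) ((integrable_const _).sub hint)).1 h1
      filter_upwards [h2] with x hx
      have : a - x = 0 := hx
      linarith
    · have h1 : ∫ x, (x - a) ∂ν = 0 := by
        rw [integral_sub hint (integrable_const _)]; simp [ha]
      have h2 := (integral_eq_zero_iff_of_nonneg_ae
        (h.mono fun x hx => by simpa using hx) (hint.sub (integrable_const _))).1 h1
      filter_upwards [h2] with x hx
      have : x - a = 0 := hx
      linarith
  rw [variance_eq_integral aemeasurable_id]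
  simp only [id]
  rw [integral_congr_ae (g := fun _ => (0 : ℝ)) (key.mono fun x hx => by simp [← ha, hx]),
    integral_zero]

/-- Finite divergence puts the rewards in the closure of the interval `meanSpace ρ`. If the mean
were outside this interval, the rewards would all lie on one side of their mean and be constant. -/
theorem mean_mem_meanSpace {ρ ν : Measure ℝ} [IsProbabilityMeasure ν]
    (hint : Integrable (fun x : ℝ => x) ν)
    (hvar : 0 < variance id ν) (hfin : ∀ᵐ x ∂ν, klMean ρ x (∫ y, y ∂ν) ≠ ∞) :
    ∫ y, y ∂ν ∈ meanSpace ρ := by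
  by_contra hμ
  have hcl : ∀ᵐ x ∂ν, x ∈ closure (meanSpace ρ) := hfin.mono fun x hx => by
    by_contra hx'
    exact hx (klMean_eq_top_of_notMem hx')
  have hord := (isPreconnected_meanSpace ρ).ordConnected
  refine hvar.ne' (variance_eq_zero_of_ae_le hint ?_)
  by_cases hex : ∃ m ∈ meanSpace ρ, m ≤ ∫ y, y ∂ν
  · obtain ⟨m, hm, hmle⟩ := hex
    have hsub : meanSpace ρ ⊆ Set.Iic (∫ y, y ∂ν) := fun x hx => by
      by_contra hx'
      exact hμ (hord.out hm hx ⟨hmle, (not_le.1 hx').le⟩)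
    exact Or.inl (hcl.mono fun x hx => closure_minimal hsub isClosed_Iic hx)
  · push Not at hex
    have hsub : meanSpace ρ ⊆ Set.Ici (∫ y, y ∂ν) := fun x hx => (hex x hx).le
    exact Or.inr (hcl.mono fun x hx => closure_minimal hsub isClosed_Ici hx)

/-! ### Bounds for the indices -/

theorem le_klSup {ρ : Measure ℝ} {I : Set ℝ} {m δ q : ℝ} (hq : q ∈ I)
    (h : klMean ρ m q ≤ ENNReal.ofReal δ) : (q : EReal) ≤ klSup ρ I m δ :=
  le_sSup ⟨q, ⟨hq, h⟩, rfl⟩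

theorem klSup_le {ρ : Measure ℝ} {I : Set ℝ} {m δ c : ℝ} (hc : 0 < c) (hδ : 0 ≤ δ)
    (hquad : ∀ q ∈ I, ENNReal.ofReal (c * (m - q) ^ 2) ≤ klMean ρ m q) :
    klSup ρ I m δ ≤ ((m + √(δ / c) : ℝ) : EReal) := by
  refine sSup_le ?_
  rintro _ ⟨q, ⟨hq, hle⟩, rfl⟩
  refine EReal.coe_le_coe_iff.2 ?_
  have h1 := (ENNReal.ofReal_le_ofReal_iff hδ).1 ((hquad q hq).trans hle)
  have h2 : |q - m| ≤ √(δ / c) := by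
    refine Real.abs_le_sqrt ?_
    rw [le_div_iff₀ hc]
    linarith [sq_nonneg (q - m), (by ring : c * (m - q) ^ 2 = (q - m) ^ 2 * c)]
  linarith [le_abs_self (q - m)]

theorem phi_nonneg (x : ℝ) : 0 ≤ phi x :=
  mul_nonneg Real.posLog_nonneg (by positivity)

/-- The bound for late times, when the exploration term may be zero. -/
theorem coe_le_index_self (alg : KLAlgorithm) (K : ℕ) {ρ : Measure ℝ} {I : Set ℝ} {m : ℝ}
    (T t n : ℕ) (hm : m ∈ I) (h : klMean ρ m m = 0) : (m : EReal) ≤ alg.index K ρ I T t n m := by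
  have hkl : ∀ δ, (m : EReal) ≤ klSup ρ I m δ := fun δ => le_klSup hm (by rw [h]; exact zero_le)
  have hadd : ∀ z : ℝ, (m : EReal) ≤ ((m + √z : ℝ) : EReal) := fun z =>
    EReal.coe_le_coe_iff.2 (le_add_of_nonneg_right (Real.sqrt_nonneg z))
  cases alg
  · exact hkl _
  · exact hkl _
  · simp only [KLAlgorithm.index, klUcbSwitchIndex]
    split_ifs
    · exact hkl _
    · exact hadd _
  · simp only [KLAlgorithm.index, anytimeKlUcbSwitchIndex]
    split_ifs
    · exact hkl _
    · exact hadd _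

theorem posLog_ge_log (x : ℝ) : Real.log x ≤ Real.posLog x := le_max_right _ _

/-- For `t ≥ T / (2K)` the ratio `T / (2 K² n)` is below `T / n`, `T / (K n)` and `t / (K n)`, so
its logarithm is a common lower bound for the exploration functions. The factor `2` in `hsq` is that
of the anytime index. -/
theorem coe_le_index (alg : KLAlgorithm) {K : ℕ} (hK : 0 < K) {ρ : Measure ℝ} {I : Set ℝ}
    {m q : ℝ} {T t n : ℕ} (hT : 0 < T) (hn : 0 < n) (ht : T ≤ 2 * K * t) (hq : q ∈ I)
    (hg : 1 ≤ Real.log (T / (2 * K ^ 2 * n)))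
    (hkl : klMean ρ m q ≤ ENNReal.ofReal (Real.log (T / (2 * K ^ 2 * n)) / n))
    (hsq : (m - q) ^ 2 ≤ Real.log (T / (2 * K ^ 2 * n)) / (2 * n)) :
    (q : EReal) ≤ alg.index K ρ I T t n m := by
  set g := Real.log (T / (2 * K ^ 2 * n)) with hgdef
  have hK' : (1 : ℝ) ≤ K := by exact_mod_cast hK
  have hn' : (0 : ℝ) < n := by exact_mod_cast hn
  have hT' : (0 : ℝ) < T := by exact_mod_cast hT
  have ht' : (T : ℝ) ≤ 2 * K * t := by exact_mod_cast ht
  have hKsq : (K : ℝ) ≤ 2 * K ^ 2 := by nlinarith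
  have hlog1 : g ≤ Real.log (T / K / n) := by
    refine Real.log_le_log (by positivity) ?_
    rw [div_div]
    gcongr
  have hlog2 : g ≤ Real.log (T / n) := by
    refine Real.log_le_log (by positivity) ?_
    refine div_le_div_of_nonneg_left hT'.le hn' ?_
    nlinarith
  have hlog3 : g ≤ Real.log (t / (K * n)) := by
    refine Real.log_le_log (by positivity) ?_
    rw [div_le_div_iff₀ (by positivity) (by positivity)]
    calc (T : ℝ) * (K * n) ≤ 2 * K * t * (K * n) := by gcongr
      _ = t * (2 * K ^ 2 * n) := by ring
  have hphi : g ≤ phi (t / (K * n)) := by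
    have h1 : g ≤ Real.posLog (t / (K * n)) := hlog3.trans (posLog_ge_log _)
    have h2 := sq_nonneg (Real.posLog ((t : ℝ) / (K * n)))
    exact h1.trans (le_mul_of_one_le_right Real.posLog_nonneg (by linarith))
  have hh : g ≤ hPlusPlus K T n := by
    -- A logarithm of at least `1` makes the squared logarithm in `hPlusPlus` harmless.
    have h1 : (1 : ℝ) ≤ Real.posLog (T / K / n) := (hg.trans hlog1).trans (posLog_ge_log _)
    have hu : (0 : ℝ) < T / K / n := by positivity
    refine (hlog1.trans (Real.log_le_log hu ?_)).trans (posLog_ge_log _)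
    nlinarith [mul_le_mul_of_nonneg_left (one_le_pow₀ h1 (n := 2)) hu.le]
  have hklSup : ∀ G : ℝ, g ≤ G → (q : EReal) ≤ klSup ρ I m (G / n) := fun G hG =>
    le_klSup hq (hkl.trans (ENNReal.ofReal_le_ofReal (by gcongr)))
  have hmoss : ∀ z : ℝ, g / (2 * n) ≤ z → (q : EReal) ≤ ((m + √z : ℝ) : EReal) := fun z hz => by
    refine EReal.coe_le_coe_iff.2 ?_
    have h1 : |m - q| ≤ √z := Real.abs_le_sqrt (hsq.trans hz)
    linarith [neg_abs_le (m - q)]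
  cases alg
  · exact hklSup _ (hlog2.trans (posLog_ge_log _))
  · exact hklSup _ hh
  · simp only [KLAlgorithm.index, klUcbSwitchIndex]
    split_ifs
    · exact hklSup _ (hlog2.trans (posLog_ge_log _))
    · refine hmoss _ ?_
      have h1 : g ≤ max 0 (Real.log (T / K / n)) := hlog1.trans (le_max_right _ _)
      exact div_le_div₀ (by linarith) h1 hn' (by linarith)
  · simp only [KLAlgorithm.index, anytimeKlUcbSwitchIndex]
    split_ifs
    · exact hklSup _ hphi
    · refine hmoss _ ?_
      rw [one_div_mul_eq_div]
      gcongr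

theorem posLog_le_one {x : ℝ} (h0 : 0 ≤ x) (h2 : x ≤ 2) : Real.posLog x ≤ 1 := by
  refine (Real.monotoneOn_posLog h0 (by norm_num : (0 : ℝ) ≤ 2) h2).trans ?_
  rw [Real.posLog_eq_log (by norm_num)]
  linarith [Real.log_two_lt_d9]

theorem posLog_le_self {x : ℝ} (h0 : 0 ≤ x) : Real.posLog x ≤ x :=
  max_le h0 (Real.log_le_self h0)

/-- Once `n ≥ T / (2K)`, the exploration functions are at most `2 * K`. The constant adds the
contribution `2 * K / c` of the divergence indices to the `2 * K` of the explicit ones. -/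
theorem index_le_coe (alg : KLAlgorithm) {K : ℕ} (hK : 2 ≤ K) {ρ : Measure ℝ} {I : Set ℝ}
    {m c : ℝ} {T t n : ℕ} (hn : 0 < n) (hTn : T ≤ 2 * K * n) (htT : t ≤ T) (hc : 0 < c)
    (hquad : ∀ q ∈ I, ENNReal.ofReal (c * (m - q) ^ 2) ≤ klMean ρ m q) :
    alg.index K ρ I T t n m ≤ ((m + √((2 * K / c + 2 * K) / n) : ℝ) : EReal) := by
  have hK' : (2 : ℝ) ≤ K := by exact_mod_cast hK
  have hn' : (0 : ℝ) < n := by exact_mod_cast hn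
  have hT' : (T : ℝ) ≤ 2 * K * n := by exact_mod_cast hTn
  have ht' : (t : ℝ) ≤ T := by exact_mod_cast htT
  have h1 : Real.posLog ((T : ℝ) / n) ≤ 2 * K :=
    (posLog_le_self (by positivity)).trans ((div_le_iff₀ hn').2 hT')
  have hu0 : (0 : ℝ) ≤ T / K / n := by positivity
  have hu : (T : ℝ) / K / n ≤ 2 := by
    rw [div_div, div_le_iff₀ (by positivity)]; linarith
  have hv : (t : ℝ) / (K * n) ≤ 2 := by
    rw [div_le_iff₀ (by positivity)]; linarith
  have h2 : hPlusPlus K T n ≤ 2 * K := by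
    have h3 := posLog_le_one hu0 hu
    have h4 : (Real.posLog ((T : ℝ) / K / n)) ^ 2 ≤ 1 := pow_le_one₀ Real.posLog_nonneg h3
    refine (posLog_le_self (by positivity)).trans ?_
    -- The bound is `2 * 1 + 1 = 3`, which needs `2 ≤ K`.
    nlinarith [mul_le_mul hu h4 (by positivity) (by norm_num)]
  have h3 : phi ((t : ℝ) / (K * n)) ≤ 2 := by
    have h4 := posLog_le_one (by positivity) hv
    have h5 : (Real.posLog ((t : ℝ) / (K * n))) ^ 2 ≤ 1 := pow_le_one₀ Real.posLog_nonneg h4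
    unfold phi
    nlinarith [mul_le_mul h4 (by linarith : 1 + (Real.posLog ((t : ℝ) / (K * n))) ^ 2 ≤ 2)
      (by positivity) (by norm_num)]
  have hkl : ∀ G : ℝ, 0 ≤ G → G ≤ 2 * K →
      klSup ρ I m (G / n) ≤ ((m + √((2 * K / c + 2 * K) / n) : ℝ) : EReal) := fun G h0 hG => by
    refine (klSup_le hc (by positivity) hquad).trans (EReal.coe_le_coe_iff.2 ?_)
    gcongr m + √?_
    rw [div_right_comm]
    gcongr
    have : G / c ≤ 2 * K / c := by gcongr
    linarith
  have hmoss : ∀ z : ℝ, z ≤ 2 * K / n →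
      ((m + √z : ℝ) : EReal) ≤ ((m + √((2 * K / c + 2 * K) / n) : ℝ) : EReal) := fun z hz => by
    refine EReal.coe_le_coe_iff.2 ?_
    gcongr m + √?_
    refine hz.trans ?_
    gcongr
    have : 0 ≤ 2 * K / c := by positivity
    linarith
  cases alg
  · exact hkl _ Real.posLog_nonneg h1
  · exact hkl _ Real.posLog_nonneg h2
  · simp only [KLAlgorithm.index, klUcbSwitchIndex]
    split_ifs
    · exact hkl _ Real.posLog_nonneg h1
    · refine hmoss _ ?_
      gcongr
      have := posLog_le_one hu0 hu
      rw [Real.posLog_apply] at this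
      linarith
  · simp only [KLAlgorithm.index, anytimeKlUcbSwitchIndex]
    split_ifs
    · exact hkl _ (phi_nonneg _) (h3.trans (by linarith))
    · refine hmoss _ ?_
      rw [one_div_mul_eq_div]
      have := phi_nonneg ((t : ℝ) / (K * n))
      exact div_le_div₀ (by positivity) (h3.trans (by linarith)) hn' (by linarith)

/-! ### Runs -/

theorem pulls_succ {K : ℕ} (A : ℕ → Fin K) (a : Fin K) (t : ℕ) :
    pulls A a (t + 1) = pulls A a t + if A t = a then 1 else 0 := by
  unfold pulls
  rw [Finset.range_add_one, Finset.filter_insert]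
  split_ifs with h
  · rw [Finset.card_insert_of_notMem (by simp)]
  · rfl

theorem pulls_le {K : ℕ} (A : ℕ → Fin K) (a : Fin K) (t : ℕ) : pulls A a t ≤ t :=
  (Finset.card_filter_le _ _).trans (Finset.card_range t).le

theorem pulls_pos_of_lt {K : ℕ} {A : ℕ → Fin K} {s t : ℕ} (h : s < t) : 0 < pulls A (A s) t :=
  Finset.card_pos.2 ⟨s, by simpa using h⟩

theorem sum_pulls {K : ℕ} (A : ℕ → Fin K) (t : ℕ) : ∑ a, pulls A a t = t := by
  unfold pulls
  rw [← Finset.card_eq_sum_card_fiberwise (fun _ _ => Finset.mem_coe.2 (Finset.mem_univ _)),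
    Finset.card_range]

theorem IsRun.pulls_pos {K : ℕ} {U : UCBIndex} {T : ℕ} {x : Fin K → ℕ → ℝ} {A : ℕ → Fin K}
    (h : IsRun U T x A) {t : ℕ} (hK : K ≤ t) (htT : t ≤ T) (b : Fin K) : 0 < pulls A b t := by
  have hne : ∀ s t' : ℕ, s < t' → t' < K → A s ≠ A t' := fun s t' hst ht' heq => by
    have h1 := (h t' (by omega)).1 ht'
    have h2 := pulls_pos_of_lt (A := A) hst
    rw [heq] at h2
    omega
  have hinj : Function.Injective (fun i : Fin K => A i) := fun i j hij => by
    rcases lt_trichotomy (i : ℕ) j with hlt | heq | hlt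
    · exact absurd hij (hne i j hlt j.2)
    · exact Fin.ext heq
    · exact absurd hij.symm (hne j i hlt i.2)
  obtain ⟨i, hi⟩ := Finite.surjective_of_injective hinj b
  rw [← hi]
  exact pulls_pos_of_lt (i.2.trans_le hK)

/-- An arm that after `n₀` pulls has an index below the indices of the other arms is not pulled
more often. -/
theorem IsRun.pulls_le_of_index_lt {K : ℕ} (hK : 2 ≤ K) {U : UCBIndex} {T : ℕ}
    {x : Fin K → ℕ → ℝ} {A : ℕ → Fin K} (h : IsRun U T x A) {a : Fin K} {n₀ : ℕ} (hn₀ : 1 ≤ n₀)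
    (v : EReal) (hUa : ∀ t, n₀ ≤ t → t < T → U T t n₀ (empMean (x a) n₀) < v)
    (hUb : ∀ b, b ≠ a → ∀ t n, n₀ ≤ t → t < T → 1 ≤ n → n ≤ t →
      v ≤ U T t n (empMean (x b) n)) : pulls A a T ≤ n₀ := by
  have key : ∀ t ≤ T, pulls A a t ≤ n₀ := by
    intro t
    induction t with
    | zero => intro _; exact (pulls_le A a 0).trans (Nat.zero_le _)
    | succ t ih =>
      intro ht
      have h1 := ih (by omega)
      rw [pulls_succ]
      split_ifs with hat
      · rcases h1.lt_or_eq with hlt | heq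
        · omega
        · exfalso
          have htn : n₀ ≤ t := heq ▸ pulls_le A a t
          -- The initial rounds pull only arms without pulls, and this arm already has `n₀ ≥ 1`.
          have hKt : K ≤ t := by
            by_contra hlt
            have := (h t (by omega)).1 (not_le.1 hlt)
            rw [hat] at this
            omega
          have : Nontrivial (Fin K) := Fin.nontrivial_iff_two_le.2 hK
          obtain ⟨b, hb⟩ := exists_ne a
          have h2 := (h t (by omega)).2 hKt b
          have h3 := hUb b hb t (pulls A b t) htn (by omega)
            (h.pulls_pos hKt (by omega) b) (pulls_le A b t)
          have h4 := hUa t htn (by omega)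
          rw [hat] at h2
          unfold ucbAt at h2
          rw [heq] at h2
          exact absurd (h4.trans_le (h3.trans h2)) (lt_irrefl _)
      · omega
  exact key T le_rfl

theorem psum_mul_sub (x : ℕ → ℝ) (s a : ℝ) {n : ℕ} (hn : 0 < n) :
    psum (fun i => s * (x i - a)) n = s * n * (empMean x n - a) := by
  have hn' : (n : ℝ) ≠ 0 := by exact_mod_cast hn.ne'
  simp only [psum, empMean, ← Finset.mul_sum, Finset.sum_sub_distrib, Finset.sum_const,
    Finset.card_range, nsmul_eq_mul]
  field_simp

theorem empMean_mem_of_convex {S : Set ℝ} (hS : Convex ℝ S) {x : ℕ → ℝ} (hx : ∀ i, x i ∈ S)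
    {n : ℕ} (hn : 0 < n) : empMean x n ∈ S := by
  have hn' : (0 : ℝ) < n := by exact_mod_cast hn
  have h := hS.sum_mem (t := Finset.range n) (w := fun _ => (n : ℝ)⁻¹) (z := x)
    (fun _ _ => by positivity) (by simp [hn'.ne']) fun i _ => hx i
  simpa only [empMean, smul_eq_mul, Finset.sum_div, inv_mul_eq_div] using h

/-- The number of pulls after which the empirical mean of the arm under consideration is low. -/
abbrev pullBound (K T : ℕ) : ℕ := T / (2 * K) + 1

theorem le_mul_pullBound {K : ℕ} (hK : 0 < K) (T : ℕ) : T ≤ 2 * K * pullBound K T :=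
  (Nat.lt_mul_div_succ T (by omega)).le

theorem one_le_log_of_le_div {K D T n : ℕ} (hK : 0 < K) (hD : 6 * K ^ 2 ≤ D) (hn : 0 < n)
    (hnT : n ≤ T / D) : 1 ≤ Real.log (T / (2 * K ^ 2 * n)) := by
  have hK' : (0 : ℝ) < K := by exact_mod_cast hK
  have hn' : (0 : ℝ) < n := by exact_mod_cast hn
  have hD0 : 0 < D := by
    have : 0 < K ^ 2 := by positivity
    omega
  have h1 : (n : ℝ) * D ≤ T := by exact_mod_cast (Nat.le_div_iff_mul_le hD0).1 hnT
  have h2 : (6 : ℝ) * K ^ 2 ≤ D := by exact_mod_cast hD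
  have h3 : (3 : ℝ) ≤ T / (2 * K ^ 2 * n) := by
    rw [le_div_iff₀ (by positivity)]
    nlinarith
  rw [Real.le_log_iff_exp_le (by linarith)]
  linarith [Real.exp_one_lt_d9]

/-! ### Indices along good and along low reward sequences -/

section Index

variable {K : ℕ} {ρ : Measure ℝ} {lo hi a C κ b s : ℝ} {D : ℕ} {x : ℕ → ℝ}

/-- The index of an arm with a good sequence of rewards is never much below the mean. -/
theorem eventually_coe_le_index (alg : KLAlgorithm) (hK : 0 < K)
    (hs : s = 1 ∧ a < hi ∨ s = -1 ∧ lo < a) (ha : a ∈ Set.Icc lo hi)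
    (hC : ∀ᶠ m in 𝓝 a, klMean ρ m a ≤ ENNReal.ofReal (C * (m - a) ^ 2) ∧ klMean ρ m m = 0)
    (hC0 : 0 < C) (hκC : κ * C ≤ 1) (hκ : κ ≤ 1 / 2) (hb : 0 ≤ b) (hD : 6 * K ^ 2 ≤ D)
    (hlim : Tendsto (fun n => empMean x n) atTop (𝓝 a))
    (hfin : ∀ n, 0 < n → klMean ρ (empMean x n) a ≠ ∞) :
    ∀ᶠ T : ℕ in atTop, (fun i => s * (x i - a)) ∈ goodSet κ (2 * K ^ 2) b D T →
      ∀ t n, T ≤ 2 * K * t → 0 < n → n ≤ T →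
        ((a - b * D / √T : ℝ) : EReal) ≤
          alg.index K ρ (Set.Icc lo hi) T t n (empMean x n) := by
  have hK' : (0 : ℝ) < K := by exact_mod_cast hK
  have hD0 : 0 < D := by
    have : 0 < K ^ 2 := by positivity
    omega
  have hD' : (0 : ℝ) < D := by exact_mod_cast hD0
  have hss : s ^ 2 = 1 := by rcases hs with ⟨rfl, _⟩ | ⟨rfl, _⟩ <;> norm_num
  -- `N` depends on the reward sequence. The quadratic bound is unavailable for the pull numbers
  -- below `N`, and a large `T` has to cover these finitely many.
  obtain ⟨N, hN⟩ := eventually_atTop.1 (hlim.eventually hC)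
  -- The sum of the two quantities that the logarithm must dominate in `coe_le_index`.
  set F : ℕ → ℝ := fun n => n * (klMean ρ (empMean x n) a).toReal + 2 * n * (empMean x n - a) ^ 2
    with hF
  have hF0 : ∀ n, 0 ≤ F n := fun n => add_nonneg (by positivity) (by positivity)
  set R := ∑ n ∈ Finset.range N, F n with hR
  have hFR : ∀ n < N, F n ≤ R := fun n hn =>
    Finset.single_le_sum (fun i _ => hF0 i) (Finset.mem_range.2 hn)
  have hlog : Tendsto (fun T : ℕ => Real.log (T / (2 * K ^ 2 * (N + 1)))) atTop atTop :=
    Real.tendsto_log_atTop.comp (tendsto_natCast_atTop_atTop.atTop_div_const (by positivity))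
  have hsmall : Tendsto (fun T : ℕ => b * D / √(T : ℝ)) atTop (𝓝 0) :=
    (Real.tendsto_sqrt_atTop.comp tendsto_natCast_atTop_atTop).const_div_atTop _
  -- The sign `s` points from `a` into the interval, so a small deviation in this direction does not
  -- leave it even if `a` is an end point.
  have hI : ∀ᶠ T : ℕ in atTop, ∀ d, 0 ≤ s * d → s * d ≤ b * D / √(T : ℝ) →
      a + d ∈ Set.Icc lo hi ∧ a - b * D / √(T : ℝ) ≤ a + d := by
    rcases hs with ⟨rfl, hlt⟩ | ⟨rfl, hlt⟩
    · filter_upwards [hsmall.eventually_le_const (sub_pos.2 hlt)] with T hT d h1 h2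
      exact ⟨⟨by linarith [ha.1], by linarith⟩, by linarith⟩
    · filter_upwards [hsmall.eventually_le_const (sub_pos.2 hlt)] with T hT d h1 h2
      exact ⟨⟨by linarith, by linarith [ha.2]⟩, by linarith⟩
  filter_upwards [hI, hlog.eventually_ge_atTop R, eventually_ge_atTop (D * N),
    eventually_gt_atTop 0] with T hIT hlogT hTN hT0 hgood t n ht hn hnT
  have hT0' : (0 : ℝ) < T := by exact_mod_cast hT0
  have hn' : (0 : ℝ) < n := by exact_mod_cast hn
  have hsT : 0 < √(T : ℝ) := Real.sqrt_pos.2 hT0'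
  have hNm : N ≤ T / D := (Nat.le_div_iff_mul_le hD0).2 (by rwa [mul_comm])
  set m := empMean x n with hm
  by_cases hnm : n ≤ T / D
  · have hg := one_le_log_of_le_div hK hD hn hnm
    set g := Real.log (T / (2 * K ^ 2 * n)) with hgdef
    refine le_trans (EReal.coe_le_coe_iff.2 (sub_le_self _ (by positivity))) ?_
    by_cases hnN : n < N
    · have h1 : F n ≤ g := by
        refine (hFR n hnN).trans (hlogT.trans (Real.log_le_log (by positivity) ?_))
        have : (n : ℝ) ≤ N + 1 := by exact_mod_cast (by omega : n ≤ N + 1)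
        gcongr
      have h2 : 0 ≤ (n : ℝ) * (klMean ρ m a).toReal := by positivity
      have h3 : 0 ≤ 2 * (n : ℝ) * (m - a) ^ 2 := by positivity
      simp only [hF, ← hm] at h1
      refine coe_le_index alg hK hT0 hn ht ha hg ?_ ?_
      · rw [← ENNReal.ofReal_toReal (hfin n hn)]
        refine ENNReal.ofReal_le_ofReal ?_
        rw [le_div_iff₀ hn', mul_comm]
        linarith
      · rw [le_div_iff₀ (by positivity), mul_comm]
        linarith
    · have h1 := hgood.1 n hn hnm
      rw [psum_mul_sub x s a hn, mul_pow, mul_pow, hss, one_mul, ← hgdef] at h1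
      have h2 : n * (m - a) ^ 2 ≤ κ * g := by
        have : (n : ℝ) * (n * (m - a) ^ 2) ≤ n * (κ * g) := by nlinarith
        exact le_of_mul_le_mul_left this hn'
      refine coe_le_index alg hK hT0 hn ht ha hg ?_ ?_
      · refine (hN n (not_lt.1 hnN)).1.trans (ENNReal.ofReal_le_ofReal ?_)
        rw [le_div_iff₀ hn']
        calc C * (m - a) ^ 2 * n = C * (n * (m - a) ^ 2) := by ring
          _ ≤ C * (κ * g) := by gcongr
          _ = κ * C * g := by ring
          _ ≤ 1 * g := by gcongr
          _ = g := one_mul g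
      · rw [le_div_iff₀ (by positivity)]
        calc (m - a) ^ 2 * (2 * n) = 2 * (n * (m - a) ^ 2) := by ring
          _ ≤ 2 * (κ * g) := by gcongr
          _ ≤ 2 * (1 / 2 * g) := by gcongr
          _ = g := by ring
  · obtain ⟨h1, h2⟩ := hgood.2 n (not_le.1 hnm).le hnT
    rw [psum_mul_sub x s a hn, ← hm] at h1 h2
    have h3 : (T : ℝ) ≤ n * D := by
      have : T < n * D := (Nat.div_lt_iff_lt_mul hD0).1 (not_le.1 hnm)
      exact_mod_cast this.le
    have h4 : 0 ≤ s * (m - a) := by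
      have : 0 ≤ (n : ℝ) * (s * (m - a)) := by linarith
      exact nonneg_of_mul_nonneg_right this hn'
    -- The sum is at most `b √T` and `n ≥ T / D`.
    have h5 : s * (m - a) ≤ b * D / √(T : ℝ) := by
      rw [le_div_iff₀ hsT]
      have h6 : (n : ℝ) * (s * (m - a) * √T) ≤ n * (b * D) := by
        calc (n : ℝ) * (s * (m - a) * √T) = s * n * (m - a) * √T := by ring
          _ ≤ b * √T * √T := by gcongr
          _ = b * T := by rw [mul_assoc, Real.mul_self_sqrt hT0'.le]
          _ ≤ b * (n * D) := by gcongr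
          _ = n * (b * D) := by ring
      exact le_of_mul_le_mul_left h6 hn'
    obtain ⟨h6, h7⟩ := hIT (m - a) h4 h5
    rw [add_sub_cancel] at h6 h7
    exact (EReal.coe_le_coe_iff.2 h7).trans
      (coe_le_index_self alg K T t n h6 (hN n (by omega)).2)

/-- The index of an arm with a low empirical mean. -/
theorem eventually_index_lt (alg : KLAlgorithm) (hK : 2 ≤ K) {c y : ℝ} (hc : 0 < c)
    (hb : 0 ≤ b) (hy : √(2 * K / c + 2 * K) + b * D < y)
    (hquad : ∀ n, 0 < n → ∀ q ∈ Set.Icc lo hi,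
      ENNReal.ofReal (c * (empMean x n - q) ^ 2) ≤ klMean ρ (empMean x n) q) :
    ∀ᶠ T : ℕ in atTop, y * √(pullBound K T) ≤ psum (fun i => -1 * (x i - a)) (pullBound K T) →
      ∀ t ≤ T, alg.index K ρ (Set.Icc lo hi) T t (pullBound K T) (empMean x (pullBound K T)) <
        ((a - b * D / √T : ℝ) : EReal) := by
  filter_upwards [eventually_ge_atTop 2] with T hT hlow t ht
  set n := pullBound K T with hn
  have hn0 : 0 < n := Nat.succ_pos _
  have hnT : n ≤ T := by
    have : T / (2 * K) ≤ T / 2 := Nat.div_le_div_left (by omega) (by omega)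
    have hn1 : n = T / (2 * K) + 1 := hn
    omega
  have hn' : (0 : ℝ) < n := by exact_mod_cast hn0
  have hnT' : (n : ℝ) ≤ T := by exact_mod_cast hnT
  have hsn : 0 < √(n : ℝ) := Real.sqrt_pos.2 hn'
  refine (index_le_coe alg hK hn0 (le_mul_pullBound (by omega) T) ht hc (hquad n hn0)).trans_lt
    (EReal.coe_lt_coe_iff.2 ?_)
  rw [psum_mul_sub x (-1) a hn0] at hlow
  have h1 : y / √n ≤ a - empMean x n := by
    rw [div_le_iff₀ hsn]
    have h2 : √(n : ℝ) * y ≤ √n * ((a - empMean x n) * √n) := by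
      calc √(n : ℝ) * y = y * √n := mul_comm _ _
        _ ≤ -1 * n * (empMean x n - a) := hlow
        _ = (√n * √n) * (a - empMean x n) := by rw [Real.mul_self_sqrt hn'.le]; ring
        _ = √n * ((a - empMean x n) * √n) := by ring
    exact le_of_mul_le_mul_left h2 hsn
  -- As `n ≤ T`, the loss of the other arms can be measured on the scale `1 / √n` of arm `j`.
  have h2 : b * D / √T ≤ b * D / √n := by gcongr
  have h3 : (√(2 * K / c + 2 * K) + b * D) / √n < y / √n := by gcongr
  rw [add_div] at h3
  rw [Real.sqrt_div' _ hn'.le]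
  linarith

end Index

/-- The deterministic core, for a fixed array of rewards: the level `a - b D / √T` separates the
index of arm `j` after `pullBound K T` pulls from all indices of the other arms. By then `t ≥
pullBound K T`, hence `T ≤ 2 K t`, as the lower bound requires. -/
theorem eventually_pulls_le {K : ℕ} {ρ : Measure ℝ} {lo hi a C κ b s c y : ℝ} {D : ℕ}
    (alg : KLAlgorithm) (hK : 2 ≤ K)
    (hs : s = 1 ∧ a < hi ∨ s = -1 ∧ lo < a) (ha : a ∈ Set.Icc lo hi)
    (hC : ∀ᶠ m in 𝓝 a, klMean ρ m a ≤ ENNReal.ofReal (C * (m - a) ^ 2) ∧ klMean ρ m m = 0)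
    (hC0 : 0 < C) (hκC : κ * C ≤ 1) (hκ : κ ≤ 1 / 2) (hb : 0 ≤ b) (hD : 6 * K ^ 2 ≤ D)
    (hc : 0 < c) (hy : √(2 * K / c + 2 * K) + b * D < y) {x : Fin K → ℕ → ℝ} {A : ℕ → ℕ → Fin K}
    (hlim : ∀ i, Tendsto (fun n => empMean (x i) n) atTop (𝓝 a))
    (hfin : ∀ i n, 0 < n → klMean ρ (empMean (x i) n) a ≠ ∞) {j : Fin K}
    (hquad : ∀ n, 0 < n → ∀ q ∈ Set.Icc lo hi,
      ENNReal.ofReal (c * (empMean (x j) n - q) ^ 2) ≤ klMean ρ (empMean (x j) n) q)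
    (hrun : ∀ T, IsRun (alg.index K ρ (Set.Icc lo hi)) T x (A T)) :
    ∀ᶠ T : ℕ in atTop, (∀ i, i ≠ j → (fun k => s * (x i k - a)) ∈ goodSet κ (2 * K ^ 2) b D T) →
      y * √(pullBound K T) ≤ psum (fun k => -1 * (x j k - a)) (pullBound K T) →
      pulls (A T) j T ≤ pullBound K T := by
  have h1 : ∀ᶠ T : ℕ in atTop, ∀ i, _ := eventually_all.2 fun i =>
    eventually_coe_le_index (x := x i) alg (by omega) hs ha hC hC0 hκC hκ hb hD (hlim i) (hfin i)
  filter_upwards [h1, eventually_index_lt (x := x j) (a := a) alg hK hc hb hy hquad]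
    with T h1 h2 hgood hlow
  refine (hrun T).pulls_le_of_index_lt hK (Nat.succ_pos _) _ (fun t _ ht => h2 hlow t ht.le) ?_
  intro i hij t n ht htT hn hnt
  refine h1 i (hgood i hij) t n ?_ hn (by omega)
  exact (le_mul_pullBound (by omega) T).trans (Nat.mul_le_mul_left _ ht)

/-- Events determined by disjoint rows of an array of independent variables are independent. -/
theorem measureReal_biInter_rows {κ Ω : Type*} [DecidableEq κ] [MeasurableSpace Ω] {P : Measure Ω}
    [IsProbabilityMeasure P] {Y : κ × ℕ → Ω → ℝ} (hY : ∀ p, Measurable (Y p))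
    (hind : iIndepFun Y P) {E : κ → Set Ω}
    (hE : ∀ i, MeasurableSet[sigmaOf Y {p | p.1 = i}] (E i)) (s : Finset κ) :
    P.real (⋂ i ∈ s, E i) = ∏ i ∈ s, P.real (E i) := by
  have hmeas : ∀ s : Finset κ, MeasurableSet[sigmaOf Y {p | p.1 ∈ s}] (⋂ i ∈ s, E i) := fun s =>
    Finset.measurableSet_biInter (m := sigmaOf Y {p | p.1 ∈ s}) s fun i hi =>
      sigmaOf_mono Y (fun p (hp : p.1 = i) => show p.1 ∈ s from hp ▸ hi) _ (hE i)
  induction s using Finset.induction_on with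
  | empty => simp
  | insert j s hj ih =>
    rw [Finset.set_biInter_insert, Finset.prod_insert hj, ← ih, measureReal_def,
      measure_inter_of_disjoint hY hind (Set.disjoint_left.2 fun p (hp : p.1 = j) hp' =>
        hj (hp ▸ hp')) (hE j) (hmeas s), ENNReal.toReal_mul]
    rfl

theorem measurableSet_row {κ Ω : Type*} {Y : κ × ℕ → Ω → ℝ} (i : κ) {f : ℝ → ℝ}
    (hf : Measurable f) {B : Set (ℕ → ℝ)} (hB : MeasurableSet B) :
    MeasurableSet[sigmaOf Y {p | p.1 = i}] {ω | (fun k => f (Y (i, k) ω)) ∈ B} := by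
  have : Measurable[sigmaOf Y {p | p.1 = i}] (fun ω k => f (Y (i, k) ω)) :=
    @measurable_pi_lambda _ _ _ (sigmaOf Y {p | p.1 = i}) _ _ fun k =>
      hf.comp (measurable_sigmaOf Y (show ((i, k) : κ × ℕ) ∈ {p : κ × ℕ | p.1 = i} from rfl))
  exact this hB

/-- The law of `s (x - ∫ y, y ∂ν)` when `x` has law `ν`. -/
noncomputable abbrev centeredLaw (ν : Measure ℝ) (s : ℝ) : Measure ℝ :=
  ν.map fun x => s * (x - ∫ y, y ∂ν)

theorem measurable_center (s a : ℝ) : Measurable fun x : ℝ => s * (x - a) := by fun_prop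

instance (ν : Measure ℝ) [IsProbabilityMeasure ν] (s : ℝ) :
    IsProbabilityMeasure (centeredLaw ν s) :=
  Measure.isProbabilityMeasure_map (measurable_center _ _).aemeasurable

/-! ### Centred and possibly reflected rewards -/

section CenteredLaw

variable {ν : Measure ℝ}

theorem integrable_of_hasSubgaussianMGF [IsProbabilityMeasure ν]
    (hsub : HasSubgaussianMGF (fun x : ℝ => x - ∫ y, y ∂ν) 1 ν) :
    Integrable (fun x : ℝ => x) ν := by
  have := hsub.integrable.add (integrable_const (∫ y, y ∂ν))
  refine this.congr (ae_of_all _ fun x => ?_)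
  simp

theorem hasSubgaussianMGF_centeredLaw
    (hsub : HasSubgaussianMGF (fun x : ℝ => x - ∫ y, y ∂ν) 1 ν) {s : ℝ} (hs : s = 1 ∨ s = -1) :
    HasSubgaussianMGF id 1 (centeredLaw ν s) := by
  rw [HasSubgaussianMGF.id_map_iff (measurable_center _ _).aemeasurable]
  rcases hs with rfl | rfl
  · simpa using hsub
  · convert hsub.neg using 1
    ext x
    simp

theorem integral_centeredLaw [IsProbabilityMeasure ν]
    (hsub : HasSubgaussianMGF (fun x : ℝ => x - ∫ y, y ∂ν) 1 ν) (s : ℝ) :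
    ∫ x, x ∂(centeredLaw ν s) = 0 := by
  rw [integral_map (f := fun x : ℝ => x) (measurable_center _ _).aemeasurable
    aestronglyMeasurable_id, integral_const_mul,
    integral_sub (integrable_of_hasSubgaussianMGF hsub) (integrable_const _)]
  simp

theorem variance_centeredLaw_pos [IsProbabilityMeasure ν] (hvar : 0 < variance id ν) {s : ℝ}
    (hs : s = 1 ∨ s = -1) : 0 < variance id (centeredLaw ν s) := by
  rw [variance_id_map (measurable_center _ _).aemeasurable, variance_const_mul]
  have h : variance (fun x : ℝ => x - ∫ y, y ∂ν) ν = variance id ν :=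
    variance_sub_const (X := id) aestronglyMeasurable_id _
  have : s ^ 2 = 1 := by rcases hs with rfl | rfl <;> norm_num
  rw [this, one_mul, h]
  exact hvar

theorem measureReal_centered_seq_eq [IsProbabilityMeasure ν] {Ω : Type*} [MeasurableSpace Ω]
    {P : Measure Ω} {Y : ℕ → Ω → ℝ} (hY : ∀ i, Measurable (Y i)) (hind : iIndepFun Y P)
    (hlaw : ∀ i, P.map (Y i) = ν) (s : ℝ) {B : Set (ℕ → ℝ)} (hB : MeasurableSet B) :
    P.real {ω | (fun i => s * (Y i ω - ∫ y, y ∂ν)) ∈ B} = (iidLaw (centeredLaw ν s)).real B := by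
  refine measureReal_seq_eq (Y := fun i ω => s * (Y i ω - ∫ y, y ∂ν))
    (fun i => (measurable_center _ _).comp (hY i))
    (hind.comp (fun _ x => s * (x - ∫ y, y ∂ν)) fun _ => measurable_center _ _) (fun i => ?_) hB
  rw [centeredLaw, ← hlaw i, Measure.map_map (measurable_center _ _) (hY i)]
  rfl

end CenteredLaw

/-- Events of positive probability for one row and for each of the other rows of an array of
independent variables with a common law occur together with positive probability. -/
theorem exists_row_events {K : ℕ} {ν : Measure ℝ} [IsProbabilityMeasure ν] {Ω : Type*}
    [MeasurableSpace Ω] {P : Measure Ω} [IsProbabilityMeasure P] {X : Fin K → ℕ → Ω → ℝ}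
    (hX : ∀ a i, Measurable (X a i)) (hlaw : ∀ a i, P.map (X a i) = ν)
    (hindep : iIndepFun (fun p : Fin K × ℕ => X p.1 p.2) P) (j : Fin K) {s s' : ℝ}
    {B B' : ℕ → Set (ℕ → ℝ)} (hB : ∀ T, MeasurableSet (B T)) (hB' : ∀ T, MeasurableSet (B' T))
    {p r : ℝ} (hp : 0 < p) (hr : 0 < r)
    (hBp : ∀ᶠ T in atTop, p ≤ (iidLaw (centeredLaw ν s)).real (B T))
    (hBr : ∀ᶠ T in atTop, r ≤ (iidLaw (centeredLaw ν s')).real (B' T)) :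
    ∃ Q : ℕ → Set Ω, (∀ T, MeasurableSet (Q T)) ∧ ∃ q : ℝ, 0 < q ∧
      (∀ᶠ T in atTop, q ≤ P.real (Q T)) ∧ ∀ T, ∀ ω ∈ Q T,
        (∀ i, i ≠ j → (fun k => s * (X i k ω - ∫ y, y ∂ν)) ∈ B T) ∧
          (fun k => s' * (X j k ω - ∫ y, y ∂ν)) ∈ B' T := by
  set a := ∫ y, y ∂ν with ha
  have hindj : ∀ i, iIndepFun (X i) P := fun i =>
    hindep.precomp (g := fun k => (i, k)) fun k k' h => (Prod.ext_iff.1 h).2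
  set E : ℕ → Fin K → Set Ω := fun T i => if i = j then
      {ω | (fun k => s' * (X i k ω - a)) ∈ B' T} else {ω | (fun k => s * (X i k ω - a)) ∈ B T}
    with hE
  have hEmeas : ∀ T i, MeasurableSet[sigmaOf (fun p : Fin K × ℕ => X p.1 p.2) {p | p.1 = i}]
      (E T i) := by
    intro T i
    simp only [hE]
    split_ifs
    · exact measurableSet_row (Y := fun p : Fin K × ℕ => X p.1 p.2) i (measurable_center s' a)
        (hB' T)
    · exact measurableSet_row (Y := fun p : Fin K × ℕ => X p.1 p.2) i (measurable_center s a)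
        (hB T)
  have hmin : 0 < min p r := lt_min hp hr
  refine ⟨fun T => ⋂ i ∈ Finset.univ, E T i, fun T => Finset.measurableSet_biInter _ fun i _ =>
    sigmaOf_le (fun p : Fin K × ℕ => hX p.1 p.2) _ _ (hEmeas T i), min p r ^ K,
    pow_pos hmin K, ?_, fun T ω hω => ?_⟩
  · filter_upwards [hBp, hBr] with T hT1 hT2
    rw [measureReal_biInter_rows (fun p : Fin K × ℕ => hX p.1 p.2) hindep (hEmeas T)]
    calc min p r ^ K = ∏ _i : Fin K, min p r := by simp
      _ ≤ _ := Finset.prod_le_prod (fun _ _ => hmin.le) fun i _ => ?_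
    simp only [hE]
    split_ifs
    · rw [measureReal_centered_seq_eq (hX i) (hindj i) (hlaw i) s' (hB' T)]
      exact (min_le_right _ _).trans hT2
    · rw [measureReal_centered_seq_eq (hX i) (hindj i) (hlaw i) s (hB T)]
      exact (min_le_left _ _).trans hT1
  · have h : ∀ i, ω ∈ E T i := fun i => Set.mem_iInter₂.1 hω i (Finset.mem_univ i)
    refine ⟨fun i hij => ?_, ?_⟩
    · have := h i
      simp only [hE, if_neg hij] at this
      exact this
    · have := h j
      simp only [hE, if_pos] at this
      exact this

theorem ae_tendsto_empMean {ν : Measure ℝ} [IsProbabilityMeasure ν]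
    (hint : Integrable (fun x : ℝ => x) ν) {Ω : Type*} [MeasurableSpace Ω] {P : Measure Ω}
    {Y : ℕ → Ω → ℝ} (hY : ∀ i, Measurable (Y i)) (hind : iIndepFun Y P)
    (hlaw : ∀ i, P.map (Y i) = ν) :
    ∀ᵐ ω ∂P, Tendsto (fun n => empMean (fun i => Y i ω) n) atTop (𝓝 (∫ y, y ∂ν)) := by
  have hI : Integrable (Y 0) P := by
    rw [← hlaw 0] at hint
    exact (integrable_map_measure aestronglyMeasurable_id (hY 0).aemeasurable).1 hint
  have h := strong_law_ae_real Y hI (fun i j hij => hind.indepFun hij) fun i =>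
    ⟨(hY i).aemeasurable, (hY 0).aemeasurable, by rw [hlaw, hlaw]⟩
  have hm : ∫ ω, Y 0 ω ∂P = ∫ y, y ∂ν := by
    rw [← hlaw 0]
    exact (integral_map (hY 0).aemeasurable aestronglyMeasurable_id).symm
  rwa [hm] at h

theorem measurable_pulls {K : ℕ} {Ω : Type*} [MeasurableSpace Ω] {A : ℕ → Ω → Fin K}
    (hA : ∀ t, Measurable (A t)) (j : Fin K) (T : ℕ) :
    Measurable fun ω => pulls (fun t => A t ω) j T := by
  simp only [pulls, Finset.card_filter]
  exact Finset.measurable_fun_sum _ fun t _ =>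
    Measurable.ite (hA t (measurableSet_singleton j)) measurable_const measurable_const

/-- Counts that add up to `T`, each of which is with probability bounded away from zero at most
half of `T / K`, are not stable. -/
theorem not_isStable_of_le_measure {K : ℕ} (hK : 2 ≤ K) {Ω : Type*} [MeasurableSpace Ω]
    {P : Measure Ω} [IsProbabilityMeasure P] {N : Fin K → ℕ → Ω → ℕ}
    (hsum : ∀ T ω, ∑ j, N j T ω = T)
    (hlow : ∀ j, ∃ p : ℝ, 0 < p ∧ ∀ᶠ T : ℕ in atTop, p ≤ P.real {ω | N j T ω ≤ pullBound K T}) :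
    ¬ IsStable P N := by
  intro hst
  choose s hs hsP using hst
  choose p hp hpP using hlow
  have hK0 : (0 : ℝ) < K := by positivity
  set Bad : Fin K → ℕ → Set Ω := fun j T => {ω | 1 / 10 ≤ dist ((N j T ω : ℝ) / s j T) 1} with hBad
  have hbad : ∀ j, Tendsto (fun T => P.real (Bad j T)) atTop (𝓝 0) := fun j =>
    tendstoInMeasure_iff_measureReal_dist.1 (hsP j) (1 / 10) (by norm_num)
  have h1 : ∀ᶠ T in atTop, ∀ j, P.real (Bad j T) < p j := eventually_all.2 fun j =>
    (hbad j).eventually_lt_const (hp j)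
  have h2 : ∀ᶠ T in atTop, ∑ j, P.real (Bad j T) < 1 := by
    have : Tendsto (fun T => ∑ j, P.real (Bad j T)) atTop (𝓝 (∑ _j : Fin K, (0 : ℝ))) :=
      tendsto_finsetSum _ fun j _ => hbad j
    rw [Finset.sum_const_zero] at this
    exact this.eventually_lt_const one_pos
  have h3 : ∀ᶠ T in atTop, ∀ j, 0 < s j T := eventually_all.2 fun j => (hs j).eventually_gt_atTop 0
  obtain ⟨T, h1, h2, h3, hpT, hT⟩ := (h1.and (h2.and (h3.and
    ((eventually_all.2 hpP).and (eventually_gt_atTop (4 * K)))))).exists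
  have hgood : ∀ j ω, ω ∉ Bad j T → 9 / 10 * s j T ≤ N j T ω ∧ (N j T ω : ℝ) ≤ 11 / 10 * s j T := by
    intro j ω hω
    have h4 : |(N j T ω : ℝ) / s j T - 1| < 1 / 10 := not_le.1 hω
    obtain ⟨h5, h6⟩ := abs_lt.1 h4
    constructor
    · rw [← le_div_iff₀ (h3 j)]; linarith
    · rw [← div_le_iff₀ (h3 j)]; linarith
  -- The event of few pulls is more likely than a bad approximation, so some outcome has few pulls
  -- and a good approximation. This bounds the nonrandom `s j T`.
  have hsle : ∀ j, 9 / 10 * s j T ≤ pullBound K T := by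
    intro j
    have hne : ¬ {ω | N j T ω ≤ pullBound K T} ⊆ Bad j T := fun h =>
      absurd ((measureReal_mono (μ := P) h).trans_lt (h1 j)) (not_lt.2 (hpT j))
    obtain ⟨ω, hω, hω'⟩ := Set.not_subset.1 hne
    exact (hgood j ω hω').1.trans (by exact_mod_cast hω)
  have hex : ∃ ω, ∀ j, ω ∉ Bad j T := by
    by_contra hcon
    push Not at hcon
    have hU : (Set.univ : Set Ω) ⊆ ⋃ j, Bad j T := fun ω _ => Set.mem_iUnion.2 (hcon ω)
    have h4 := (measureReal_mono (μ := P) hU).trans (measureReal_iUnion_fintype_le _)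
    rw [probReal_univ] at h4
    linarith
  obtain ⟨ω, hω⟩ := hex
  have hle : ∀ j ∈ Finset.univ, (N j T ω : ℝ) ≤ 11 / 9 * pullBound K T := fun j _ => by
    have := (hgood j ω (hω j)).2
    have := hsle j
    linarith
  have h4 : (T : ℝ) ≤ K * (11 / 9 * pullBound K T) := by
    have h5 := Finset.sum_le_sum hle
    rw [← Nat.cast_sum, hsum] at h5
    simpa using h5
  have h6 : (pullBound K T : ℝ) ≤ T / (2 * K) + 1 := by
    simp only [pullBound]
    push_cast
    have := Nat.cast_div_le (α := ℝ) (m := T) (n := 2 * K)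
    push_cast at this
    linarith
  -- The tolerance `1 / 10` costs the factor `11 / 9`, which is less than the `2` gained in
  -- `pullBound`.
  have h7 : (T : ℝ) ≤ 11 / 18 * T + 11 / 9 * K := by
    calc (T : ℝ) ≤ K * (11 / 9 * (T / (2 * K) + 1)) := h4.trans (by gcongr)
      _ = 11 / 18 * T + 11 / 9 * K := by field_simp; ring
  have h8 : (4 : ℝ) * K < T := by exact_mod_cast hT
  linarith

/-- The threshold in `eventually_pulls_le` depends on the outcome, so the reward event `Q T` need
not force few pulls at any given `T`. Almost every outcome is an exception for only finitely many
`T`, so the exceptional probability tends to zero, while that of `Q T` stays bounded below. -/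
theorem exists_pos_le_measure_pulls_le
    {K : ℕ} (hK : 2 ≤ K) {ρ : Measure ℝ} {lo hi : ℝ} (hlohi : lo < hi)
    (hI : Set.Icc lo hi ⊆ closure (meanSpace ρ)) {ν : Measure ℝ} [IsProbabilityMeasure ν]
    (hsub : HasSubgaussianMGF (fun x : ℝ => x - ∫ y, y ∂ν) 1 ν) (hvar : 0 < variance id ν)
    (hmean : ∫ y, y ∂ν ∈ Set.Icc lo hi) (hfin : ∀ᵐ x ∂ν, klMean ρ x (∫ y, y ∂ν) ≠ ∞)
    {c : ℝ} (hc : 0 < c)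
    (hquad : ∀ x ∈ convexHull ℝ ν.support, ∀ q ∈ Set.Icc lo hi,
      ENNReal.ofReal (c * (x - q) ^ 2) ≤ klMean ρ x q)
    {Ω : Type*} [MeasurableSpace Ω] {P : Measure Ω} [IsProbabilityMeasure P]
    {X : Fin K → ℕ → Ω → ℝ} (hX : ∀ a i, Measurable (X a i)) (hlaw : ∀ a i, P.map (X a i) = ν)
    (hindep : iIndepFun (fun p : Fin K × ℕ => X p.1 p.2) P) (alg : KLAlgorithm)
    {A : ℕ → ℕ → Ω → Fin K} (hA : ∀ T t, Measurable (A T t))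
    (hrun : ∀ T, ∀ᵐ ω ∂P, IsRun (alg.index K ρ (Set.Icc lo hi)) T
      (fun a i => X a i ω) (fun t => A T t ω)) (j : Fin K) :
    ∃ p : ℝ, 0 < p ∧ ∀ᶠ T : ℕ in atTop,
      p ≤ P.real {ω | pulls (fun t => A T t ω) j T ≤ pullBound K T} := by
  set a := ∫ y, y ∂ν with ha
  have hnt : (meanSpace ρ).Nontrivial := by
    by_contra h
    exact hlohi.ne ((Set.not_nontrivial_iff.1 h).closure (hI ⟨le_rfl, hlohi.le⟩)
      (hI ⟨hlohi.le, le_rfl⟩))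
  have hint := integrable_of_hasSubgaussianMGF hsub
  have haM := mean_mem_meanSpace hint hvar hfin
  obtain ⟨C, hC0, hC⟩ := exists_klMean_le_sq hnt haM
  have hCe : ∀ᶠ m in 𝓝 a, klMean ρ m a ≤ ENNReal.ofReal (C * (m - a) ^ 2) ∧ klMean ρ m m = 0 := by
    filter_upwards [hC, meanSpace_mem_nhds hnt haM] with m h1 h2 using
      ⟨h1, klMean_self_eq_zero hnt h2⟩
  obtain ⟨s, hs, hs1⟩ : ∃ s : ℝ, (s = 1 ∧ a < hi ∨ s = -1 ∧ lo < a) ∧ (s = 1 ∨ s = -1) := by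
    rcases lt_or_ge a hi with h | h
    · exact ⟨1, Or.inl ⟨rfl, h⟩, Or.inl rfl⟩
    · exact ⟨-1, Or.inr ⟨rfl, hlohi.trans_le h⟩, Or.inr rfl⟩
  -- `1 / C` serves the divergence indices, and `1 / 2` the explicit ones.
  set κ : ℝ := min (1 / C) (1 / 2) with hκ
  have hκ0 : 0 < κ := lt_min (by positivity) (by norm_num)
  have hκC : κ * C ≤ 1 := (le_div_iff₀ hC0).1 (min_le_left _ _)
  have hL : (0 : ℝ) < 2 * K ^ 2 := by positivity
  obtain ⟨D, hD, b, hb, p, hp, T₀, hgood⟩ := exists_pos_le_measure_goodSet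
    (hasSubgaussianMGF_centeredLaw hsub hs1) (integral_centeredLaw hsub s)
    (variance_centeredLaw_pos hvar hs1) hκ0 hL (6 * K ^ 2)
  -- The mean of arm `j` must be low enough to absorb its own bonus and the loss `b D` of the other
  -- arms.
  set y := √(2 * K / c + 2 * K) + b * D + 1 with hy
  obtain ⟨r, hr, N, hlow⟩ := exists_pos_le_measure_psum
    (hasSubgaussianMGF_centeredLaw hsub (Or.inr rfl)) (integral_centeredLaw hsub (-1))
    (variance_centeredLaw_pos hvar (Or.inr rfl)) y
  have hindj : ∀ i, iIndepFun (X i) P := fun i =>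
    hindep.precomp (g := fun k => (i, k)) fun k k' h => (Prod.ext_iff.1 h).2
  have hpb : Tendsto (fun T => pullBound K T) atTop atTop :=
    tendsto_atTop_mono (fun T => Nat.le_succ _)
      (Nat.tendsto_div_const_atTop (n := 2 * K) (by omega))
  obtain ⟨Q, hQmeas, p', hp'0, hQp, hQ⟩ := exists_row_events hX hlaw hindep j
    (B := fun T => goodSet κ (2 * K ^ 2) b D T)
    (B' := fun T => {z | y * √(pullBound K T) ≤ psum z (pullBound K T)})
    (fun T => measurableSet_goodSet _ _ _ _ _) (fun T => (measurable_psum _) measurableSet_Ici)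
    hp hr (eventually_atTop.2 ⟨T₀, hgood⟩) ((hpb.eventually_ge_atTop N).mono fun T hT => hlow _ hT)
  have hXae : ∀ {q : ℝ → Prop}, (∀ᵐ x ∂ν, q x) → ∀ᵐ ω ∂P, ∀ i k, q (X i k ω) := fun hq =>
    ae_all_iff.2 fun i => ae_all_iff.2 fun k => by
      rw [← hlaw i k] at hq
      exact ae_of_ae_map (hX i k).aemeasurable hq
  have hlim : ∀ᵐ ω ∂P, ∀ i, Tendsto (fun n => empMean (fun k => X i k ω) n) atTop (𝓝 a) :=
    ae_all_iff.2 fun i => ae_tendsto_empMean hint (hX i) (hindj i) (hlaw i)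
  have hfin' := hXae hfin
  have hsupp := hXae (Measure.support_mem_ae (μ := ν))
  set Z : ℕ → Set Ω := fun T =>
    Q T ∩ {ω | pulls (fun t => A T t ω) j T ≤ pullBound K T}ᶜ with hZ
  have hZmeas : ∀ T, MeasurableSet (Z T) := fun T =>
    (hQmeas T).inter ((measurable_pulls (hA T) j T) measurableSet_Iic).compl
  have hZae : ∀ᵐ ω ∂P, ∀ᶠ T in atTop, ω ∈ Z T ↔ ω ∈ (∅ : Set Ω) := by
    filter_upwards [hlim, hfin', hsupp, ae_all_iff.2 hrun] with ω h1 h2 h3 h4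
    have h5 := eventually_pulls_le (x := fun i k => X i k ω) (j := j) (y := y) alg hK hs hmean hCe
      hC0 hκC (min_le_right _ _) hb hD hc (lt_add_one _) h1
      (fun i n hn => empMean_mem_of_convex (convex_klMean_ne_top hnt haM) (h2 i) hn)
      (fun n hn => hquad _ (empMean_mem_of_convex (convex_convexHull ℝ _)
        (fun k => subset_convexHull ℝ _ (h3 j k)) hn)) h4
    filter_upwards [h5] with T h5
    refine iff_of_false ?_ (Set.notMem_empty _)
    rintro ⟨hωQ, hωp⟩
    exact hωp (h5 (hQ T ω hωQ).1 (hQ T ω hωQ).2)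
  -- Dominated convergence for the indicators of the exceptional sets.
  have hZlim := tendsto_measure_of_ae_tendsto_indicator_of_isFiniteMeasure (μ := P) atTop
    MeasurableSet.empty hZmeas hZae
  rw [measure_empty] at hZlim
  have hZlim' : Tendsto (fun T => P.real (Z T)) atTop (𝓝 0) :=
    (ENNReal.tendsto_toReal ENNReal.zero_ne_top).comp hZlim
  refine ⟨p' / 2, by positivity, ?_⟩
  filter_upwards [hQp, hZlim'.eventually_le_const (show 0 < p' / 2 by positivity)]
    with T h1 h2
  have h3 : Q T ⊆ {ω | pulls (fun t => A T t ω) j T ≤ pullBound K T} ∪ Z T := fun ω hω => by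
    by_cases h : pulls (fun t => A T t ω) j T ≤ pullBound K T
    · exact Or.inl h
    · exact Or.inr ⟨hω, h⟩
  have h4 := (measureReal_mono (μ := P) h3).trans (measureReal_union_le _ _)
  linarith

end KLBandit

open KLBandit in
theorem corollary2
    -- the number of arms
    (K : ℕ) (hK : 2 ≤ K)
    -- the exponential family that defines the divergence, and the compact interval of means
    (ρ : Measure ℝ) (lo hi : ℝ) (hlohi : lo < hi)
    (hI : Set.Icc lo hi ⊆ closure (meanSpace ρ))
    -- the common reward law: 1-sub-Gaussian, nondegenerate, with mean in the interval
    (ν : Measure ℝ) [IsProbabilityMeasure ν]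
    (hsub : HasSubgaussianMGF (fun x : ℝ => x - ∫ y, y ∂ν) 1 ν)
    (hvar : 0 < variance id ν)
    (hmean : ∫ y, y ∂ν ∈ Set.Icc lo hi)
    -- the divergence makes sense at the rewards, and has the quadratic lower bound
    (hfin : ∀ᵐ x ∂ν, klMean ρ x (∫ y, y ∂ν) ≠ ∞)
    (c : ℝ) (hc : 0 < c)
    (hquad : ∀ x ∈ convexHull ℝ ν.support, ∀ q ∈ Set.Icc lo hi,
      ENNReal.ofReal (c * (x - q) ^ 2) ≤ klMean ρ x q)
    -- the rewards: `X a i` is the reward of the `(i + 1)`-st pull of arm `a`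
    {Ω : Type*} [MeasurableSpace Ω] (P : Measure Ω) [IsProbabilityMeasure P]
    (X : Fin K → ℕ → Ω → ℝ)
    (hX : ∀ a i, Measurable (X a i))
    (hlaw : ∀ a i, P.map (X a i) = ν)
    (hindep : iIndepFun (fun p : Fin K × ℕ => X p.1 p.2) P)
    -- one of the four algorithms, run for each horizon `T`
    (alg : KLAlgorithm)
    (A : ℕ → ℕ → Ω → Fin K)
    (hA : ∀ T t, Measurable (A T t))
    (hrun : ∀ T, ∀ᵐ ω ∂P, IsRun (alg.index K ρ (Set.Icc lo hi)) T
      (fun a i => X a i ω) (fun t => A T t ω)) :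
    ¬ IsStable P (fun a T ω => pulls (fun t => A T t ω) a T) :=
  not_isStable_of_le_measure hK (fun _ _ => sum_pulls _ _)
    (exists_pos_le_measure_pulls_le hK hlohi hI hsub hvar hmean hfin hc hquad hX hlaw hindep alg
      hA hrun)
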